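/- Let $\mathbb F$ be a subfield of $\mathbb C$ such that $\bar x\in\mathbb F$ for all $x\in\mathbb F$ and $\sqrt y\in\mathbb F$ for all $y\in\mathbb F$ with $y>0$. Let $1\le r\le s$ and let $P$ be an $r\times s$ matrix of Laurent polynomials with coefficients in $\mathbb F$. Notation. For $P(z)=\sum_k P_kz^k$ put $P^*(z)=\sum_k \overline{P_k}^{T}z^{-k}$. A Laurent polynomial $p=\sum_k p_kz^k$ has symmetry pattern $\mathcal Sp=\varepsilon z^c$ ($\varepsilon\in\{-1,1\}$, $c\in\mathbb Z$) if $p_{c-k}=\varepsilon p_k$ for all $k$; the zero polynomial has every symmetry pattern. For a matrix $P$ of Laurent polynomials with symmetry, a pattern matrix $\mathcal SP$ is obtained entrywise, with some choice at the zero entries. A pattern vector is a row vector $\sigma=[\varepsilon_1z^{c_1},\dots,\varepsilon_nz^{c_n}]$ (equivalently $\sigma=\mathcal S\theta$ for a row vector $\theta$ of Laurent polynomials with symmetry). $P$ has compatible symmetry if $\mathcal SP=\sigma_1^*\sigma_2$ for some pattern vectors $\sigma_1,\sigma_2$ and some choice of $\mathcal SP$. Pattern matrices $\mathcal SP,\mathcal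 SQ$ are mutually compatible if $\mathcal SP=\sigma_1^*\sigma$ and $\mathcal SQ=\sigma^*\sigma_2$ for some pattern vectors $\sigma_1,\sigma,\sigma_2$. For $p\ne0$ let $|\mathrm{cs}(p)|=n-m$, where $m$ and $n$ are the least and the greatest $k$ with $p_k\neq0$; $|\mathrm{cs}(0)|=-\infty$. For $\sigma=[\varepsilon_1z^{c_1},\dots,\varepsilon_nz^{c_n}]$, let $U_\sigma$ denote any matrix $\mathrm{diag}(z^{-\lceil c_1/2\rceil},\dots,z^{-\lceil c_n/2\rceil})E$, where $E$ is a permutation matrix that groups the patterns $\varepsilon_iz^{c_i-2\lceil c_i/2\rceil}\in\{\pm1,\pm z^{-1}\}$ in the order $1,\dots,1,-1,\dots,-1,z^{-1},\dots,z^{-1},-z^{-1},\dots,-z^{-1}$. Theorem. $PP^*=I_r$ and $P$ has compatible symmetry if and only if, for some pattern vectors $\sigma_1$ (of size $r$) and $\sigma_2$ (of size $s$) and some choice of $U_{\sigma_1},U_{\sigma_2}$, there exist $J\ge0$ and $s\times s$ matrices $P_0,\dots,P_{J+1}$ of Laurent polynomials with coefficients in $\mathbb F$ such that 1. $P_e:=P_{J+1}P_J\cdots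 P_1P_0$ is paraunitary: $P_eP_e^*=I_s$; 2. $P=[I_r,\mathbf 0]\,P_{J+1}P_J\cdots P_1P_0$; 3. $P_j$, $1\le j\le J$, is elementary: $P_jP_j^*=I_s$ and the coefficients of $z^k$ in $P_j$ vanish for $k\notin[-1,1]$; 4. for each $0\le j\le J+1$ one can choose a pattern matrix $\mathcal SP_j$ of $P_j$ so that $\mathcal SP_{j+1},\mathcal SP_j$ are mutually compatible for all $0\le j\le J$; 5. $P_0=U_{\sigma_2}^*$ and $P_{J+1}=\mathrm{diag}(U_{\sigma_1},I_{s-r})$; 6. $J\le\max\bigl\{1,\ \max_{1\le m\le r,\,1\le n\le s}\lceil|\mathrm{cs}([P]_{m,n})|/2\rceil\bigr\}$. Moreover, if $PP^*=I_r$ and $\mathcal SP=\sigma_1^*\sigma_2$ for some choice of $\mathcal SP$, then such $J,P_0,\dots,P_{J+1}$ exist for these $\sigma_1,\sigma_2$ and every choice of $U_{\sigma_1},U_{\sigma_2}$. -/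

import Mathlib

open scoped LaurentPolynomial

noncomputable section

namespace SymExt

/-- Matrices of Laurent polynomials with complex coefficients. -/
abbrev LMat (r s : ℕ) := Matrix (Fin r) (Fin s) ℂ[T;T⁻¹]

/-- A subfield of `ℂ` closed under complex conjugation and under (positive) square roots of its
positive elements. -/
def IsAdmissibleField (K : Subfield ℂ) : Prop :=
  (∀ x ∈ K, (starRingEnd ℂ) x ∈ K) ∧
  (∀ y : ℝ, 0 < y → (y : ℂ) ∈ K → ((Real.sqrt y : ℝ) : ℂ) ∈ K)

/-- All coefficients of all entries of `P` lie in `K`. -/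
def HasCoeffsIn (K : Subfield ℂ) {r s : ℕ} (P : LMat r s) : Prop :=
  ∀ i j k, (P i j).coeff k ∈ K

/-- `p*(z) = ∑ conj(p_k) z^{-k}` for `p(z) = ∑ p_k z^k`. -/
def pstar (p : ℂ[T;T⁻¹]) : ℂ[T;T⁻¹] :=
  LaurentPolynomial.invert (AddMonoidAlgebra.mapRingHom ℤ (starRingEnd ℂ) p)

/-- `P*(z) = ∑ P_k* z^{-k}` for `P(z) = ∑ P_k z^k`, where `P_k*` is the conjugate transpose. -/
def mstar {r s : ℕ} (P : LMat r s) : LMat s r :=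
  fun j i => pstar (P i j)

/-- `P(z) P*(z) = I_r`; for square matrices this says that `P` is paraunitary. -/
def IsParaunitary {r s : ℕ} (P : LMat r s) : Prop :=
  P * mstar P = 1

/-! ### Symmetry -/

/-- A symmetry pattern `ε z^c` with `ε ∈ {-1, 1}` and `c ∈ ℤ`. -/
structure SymType where
  sign : ℤˣ
  exp : ℤ

/-- `𝒮p = ε z^c`, that is, `p_{c-k} = ε p_k` for all `k`. The zero polynomial has every symmetry
pattern; a nonzero polynomial has at most one. -/
def HasSym (p : ℂ[T;T⁻¹]) (σ : SymType) : Prop :=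
  ∀ k : ℤ, p.coeff (σ.exp - k) = ((σ.sign : ℤ) : ℂ) * p.coeff k

/-- `S` is a symmetry pattern `𝒮P` of the matrix `P` (with some choice at the zero entries). -/
def HasSymMatrix {r s : ℕ} (P : LMat r s) (S : Matrix (Fin r) (Fin s) SymType) : Prop :=
  ∀ i j, HasSym (P i j) (S i j)

/-- The pattern matrix `(𝒮θ₁)* 𝒮θ₂`, for row vectors `σ₁ = 𝒮θ₁` and `σ₂ = 𝒮θ₂` of patterns: its
`(i,j)` entry is `(ε_i z^{c_i})* (ε'_j z^{c'_j}) = ε_i ε'_j z^{c'_j - c_i}`. Every vector of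
patterns is `𝒮θ` for some row vector `θ` of nonzero Laurent polynomials with symmetry, see
`exists_ne_zero_hasSym`, so below we quantify over the pattern vectors themselves. -/
def starMul {r s : ℕ} (σ₁ : Fin r → SymType) (σ₂ : Fin s → SymType) :
    Matrix (Fin r) (Fin s) SymType :=
  fun i j => ⟨(σ₁ i).sign * (σ₂ j).sign, (σ₂ j).exp - (σ₁ i).exp⟩

/-- `P` has compatible symmetry: `𝒮P = (𝒮θ₁)* 𝒮θ₂` for some `θ₁`, `θ₂`. -/
def HasCompatibleSym {r s : ℕ} (P : LMat r s) : Prop :=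
  ∃ (σ₁ : Fin r → SymType) (σ₂ : Fin s → SymType), HasSymMatrix P (starMul σ₁ σ₂)

/-- Mutual compatibility of the symmetry patterns `S = 𝒮P` and `S' = 𝒮Q`:
`𝒮P = (𝒮θ₁)* 𝒮θ` and `𝒮Q = (𝒮θ)* 𝒮θ₂` for some `θ₁`, `θ`, `θ₂`. -/
def MutuallyCompatible {r s t : ℕ} (S : Matrix (Fin r) (Fin s) SymType)
    (S' : Matrix (Fin s) (Fin t) SymType) : Prop :=
  ∃ (σ₁ : Fin r → SymType) (σ : Fin s → SymType) (σ₂ : Fin t → SymType),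
    S = starMul σ₁ σ ∧ S' = starMul σ σ₂

theorem exists_ne_zero_hasSym (σ : SymType) : ∃ p : ℂ[T;T⁻¹], p ≠ 0 ∧ HasSym p σ := by
  obtain ⟨n, hn⟩ : ∃ n : ℤ, σ.exp - n ≠ n := ⟨σ.exp + 1 + |σ.exp|, by
    have := neg_abs_le σ.exp; have := abs_nonneg σ.exp; omega⟩
  have hs : ((σ.sign : ℤ) : ℂ) * ((σ.sign : ℤ) : ℂ) = 1 := by
    rcases Int.units_eq_one_or σ.sign with h | h <;> simp [h]
  have hc : ∀ k : ℤ, (AddMonoidAlgebra.single n (1 : ℂ)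
      + AddMonoidAlgebra.single (σ.exp - n) ((σ.sign : ℤ) : ℂ) : ℂ[T;T⁻¹]).coeff k =
      (if n = k then 1 else 0) + (if σ.exp - n = k then ((σ.sign : ℤ) : ℂ) else 0) := by
    intro k
    rw [AddMonoidAlgebra.coeff_add, Finsupp.add_apply, AddMonoidAlgebra.coeff_single,
      AddMonoidAlgebra.coeff_single, Finsupp.single_apply, Finsupp.single_apply]
  refine ⟨AddMonoidAlgebra.single n (1 : ℂ)
      + AddMonoidAlgebra.single (σ.exp - n) ((σ.sign : ℤ) : ℂ), fun h => ?_, fun k => ?_⟩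
  · have h2 := hc n
    rw [h, if_pos rfl, if_neg hn] at h2
    simp at h2
  · have e1 : (n = σ.exp - k) ↔ (σ.exp - n = k) := by omega
    have e2 : (σ.exp - n = σ.exp - k) ↔ (n = k) := by omega
    rw [hc, hc]
    simp only [e1, e2, mul_add, mul_ite, mul_one, mul_zero, hs]
    rw [add_comm]

/-! ### Coefficient support -/

/-- The length `n - m` of the coefficient support `[m, n]` of `p`, which is `-∞` for `p = 0`. -/
def csLength (p : ℂ[T;T⁻¹]) : WithBot ℕ :=
  open scoped Classical in
  if h : p.coeff.support.Nonempty then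
    (((p.coeff.support.max' h - p.coeff.support.min' h).toNat : ℕ) : WithBot ℕ)
  else ⊥

/-- `max_{m,n} ⌈|cs([P]_{m,n})| / 2⌉`. -/
def maxHalfLength {r s : ℕ} (P : LMat r s) : WithBot ℕ :=
  Finset.univ.sup fun mn : Fin r × Fin s =>
    (csLength (P mn.1 mn.2)).map fun l : ℕ => ⌈(l : ℚ) / 2⌉₊

/-- `cs(P) ⊆ [-1, 1]`. -/
def SupportedInUnit {r s : ℕ} (P : LMat r s) : Prop :=
  ∀ i j k, (P i j).coeff k ≠ 0 → -1 ≤ k ∧ k ≤ 1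

/-- Elementary matrices: paraunitary with coefficient support contained in `[-1, 1]`. -/
def IsElementary {s : ℕ} (P : LMat s s) : Prop :=
  IsParaunitary P ∧ SupportedInUnit P

/-! ### The monomial matrices `U_{𝒮θ}` -/

/-- The pattern `ε z^{c - 2⌈c/2⌉} ∈ {±1, ±z⁻¹}` of `θ_i z^{-⌈c/2⌉}` when `𝒮θ_i = ε z^c`. -/
def SymType.normalize (σ : SymType) : SymType :=
  ⟨σ.sign, σ.exp - 2 * ⌈(σ.exp : ℚ) / 2⌉⟩

/-- The position of a normalized pattern in the list `1, -1, z⁻¹, -z⁻¹`. -/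
def SymType.rank (σ : SymType) : ℕ :=
  (if σ.exp = 0 then 0 else 2) + (if σ.sign = 1 then 0 else 1)

/-- `U` is a matrix `U_{𝒮θ} = diag(z^{-⌈c_1/2⌉}, …, z^{-⌈c_n/2⌉}) E_θ`, where
`𝒮θ = σ = [ε_1 z^{c_1}, …, ε_n z^{c_n}]` and `E_θ` is a permutation matrix such that
`𝒮(θ U) = [1_{n_1}, -1_{n_2}, z⁻¹ 1_{n_3}, -z⁻¹ 1_{n_4}]`. The `k`-th entry of `θ U` is
`θ_i z^{-⌈c_i/2⌉}` with `i = e.symm k`, so the latter says that the positions of the normalized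
patterns in the list `1, -1, z⁻¹, -z⁻¹` are monotone in `k`. -/
def IsReorganizer {n : ℕ} (σ : Fin n → SymType) (U : LMat n n) : Prop :=
  ∃ e : Equiv.Perm (Fin n),
    U = Matrix.diagonal (fun i => LaurentPolynomial.T (-⌈((σ i).exp : ℚ) / 2⌉))
          * e.permMatrix ℂ[T;T⁻¹] ∧
    Monotone fun k => (σ (e.symm k)).normalize.rank

/-! ### The factorization -/

/-- The `r × s` matrix `[I_r, 0]`. -/
def firstRows (r s : ℕ) : LMat r s :=
  fun i j => if (i : ℕ) = j then 1 else 0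

/-- The `s × s` matrix `diag(U, I_{s-r})` (for `r ≤ s`). -/
def extendById {r : ℕ} (s : ℕ) (U : LMat r r) : LMat s s :=
  fun i j =>
    if h : (i : ℕ) < r ∧ (j : ℕ) < r then U ⟨i, h.1⟩ ⟨j, h.2⟩
    else if i = j then 1 else 0

/-- The product `P_{J+1} P_J ⋯ P_1 P_0`. -/
def descProd {s J : ℕ} (F : Fin (J + 2) → LMat s s) : LMat s s :=
  (List.ofFn fun j => F j.rev).prod

/-- `P = [I_r, 0] P_{J+1} ⋯ P_0` is a cascade factorization of `P` over `K` with the given outer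
factors `P_0 = U₂*` and `P_{J+1} = diag(U₁, I_{s-r})`. -/
structure IsCascade (K : Subfield ℂ) {r s : ℕ} (P : LMat r s) (U₁ : LMat r r) (U₂ : LMat s s)
    (J : ℕ) (F : Fin (J + 2) → LMat s s) : Prop where
  coeffs : ∀ j, HasCoeffsIn K (F j)
  paraunitary : IsParaunitary (descProd F)
  product : P = firstRows r s * descProd F
  elementary : ∀ j : Fin (J + 2), 1 ≤ (j : ℕ) → (j : ℕ) ≤ J → IsElementary (F j)
  /-- A symmetry pattern is chosen once for each factor, and the patterns of consecutive factors
  are mutually compatible. -/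
  symm : ∃ S : Fin (J + 2) → Matrix (Fin s) (Fin s) SymType,
    (∀ j, HasSymMatrix (F j) (S j)) ∧
    ∀ j : Fin (J + 1), MutuallyCompatible (S j.succ) (S j.castSucc)
  first : F 0 = mstar U₂
  last : F (Fin.last (J + 1)) = extendById s U₁
  bound : (J : WithBot ℕ) ≤ max 1 (maxHalfLength P)

end SymExt

end

/-!
Substitute `z = w²` and centre every entry at the midpoint of its symmetry. An entry with pattern
`ε_i ε_j z ^ (c_j - c_i)` then has the symmetry `w ↦ w⁻¹` up to the sign `ε_i ε_j`, and the
exponents `c_i` only prescribe the parity of its exponents in `w`. The top coefficient of a row is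
its bottom coefficient up to signs, so `P P* = 1` makes the bottom coefficient vectors of the rows
of positive degree isotropic and mutually orthogonal for the indefinite form `∑ ε_j x_j conj(y_j)`.

An isotropic vector is rotated, within the classes of columns of equal pattern, to a multiple of
`e_p + e_q` with `ε_p = 1`, `ε_q = -1`. The block that multiplies `e_p + e_q` by `w` and `e_p - e_q`
by `w⁻¹` shortens the row with this bottom coefficient vector and lengthens no row orthogonal to
it. Repeating this lowers the degree of `P` by `2` in `w`. The bottom coefficient vectors of the
product of the blocks stay orthogonal to those of the remaining rows, so this product itself has
degree at most `2`: it is one elementary factor. When degree `0` is reached, a constant isometry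
remains, which is completed to a unitary matrix.
-/

noncomputable section

namespace SymExt

open LaurentPolynomial Matrix

/-! ### Unitary matrices over the subfield -/

section Unitary

open scoped ComplexOrder

variable {K : Subfield ℂ} {m n p : Type*} [Fintype n] {α : Type*}
  {a : m → α} {b : n → α}

theorem IsAdmissibleField.star_mem (hK : IsAdmissibleField K) {x : ℂ} (hx : x ∈ K) :
    star x ∈ K :=
  hK.1 x hx

/-- A matrix over `K` with orthonormal rows whose rows and columns carry labels and whose entries
vanish unless the two labels agree: it mixes only coordinates with the same label. -/
structure IsLabeledIsometry [DecidableEq m] (K : Subfield ℂ) (a : m → α) (b : n → α)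
    (V : Matrix m n ℂ) : Prop where
  mul_conjTranspose : V * Vᴴ = 1
  mem : ∀ i j, V i j ∈ K
  label_eq : ∀ i j, V i j ≠ 0 → a i = b j

namespace IsLabeledIsometry

protected theorem one [DecidableEq n] : IsLabeledIsometry K b b 1 where
  mul_conjTranspose := by rw [conjTranspose_one, one_mul]
  mem i j := by rw [one_apply]; split_ifs; exacts [K.one_mem, K.zero_mem]
  label_eq i j h := congrArg b (not_imp_comm.1 one_apply_ne h)

variable [DecidableEq m]

protected theorem mul [Fintype p] [DecidableEq n] {c : p → α} {V : Matrix m n ℂ}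
    {W : Matrix n p ℂ} (hV : IsLabeledIsometry K a b V) (hW : IsLabeledIsometry K b c W) :
    IsLabeledIsometry K a c (V * W) where
  mul_conjTranspose := by
    rw [conjTranspose_mul, Matrix.mul_assoc, ← Matrix.mul_assoc W, hW.mul_conjTranspose,
      Matrix.one_mul, hV.mul_conjTranspose]
  mem i j := K.sum_mem fun l _ => K.mul_mem (hV.mem i l) (hW.mem l j)
  label_eq i j h := by
    obtain ⟨l, -, hl⟩ := Finset.exists_ne_zero_of_sum_ne_zero h
    exact (hV.label_eq i l (left_ne_zero_of_mul hl)).trans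
      (hW.label_eq l j (right_ne_zero_of_mul hl))

protected theorem conjTranspose [DecidableEq n] (hK : IsAdmissibleField K) {a : n → α}
    {V : Matrix n n ℂ} (hV : IsLabeledIsometry K a b V) : IsLabeledIsometry K b a Vᴴ where
  mul_conjTranspose := by
    rw [conjTranspose_conjTranspose]
    exact mul_eq_one_comm.1 hV.mul_conjTranspose
  mem i j := hK.star_mem (hV.mem j i)
  label_eq i j h := (hV.label_eq j i (star_ne_zero.1 h)).symm

theorem submatrix_left {l : Type*} [DecidableEq l] {V : Matrix m n ℂ}
    (hV : IsLabeledIsometry K a b V) {f : l → m} (hf : Function.Injective f) :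
    IsLabeledIsometry K (a ∘ f) b (V.submatrix f id) where
  mul_conjTranspose := by
    rw [conjTranspose_submatrix, ← submatrix_mul V Vᴴ f id f Function.bijective_id,
      hV.mul_conjTranspose, submatrix_one f hf]
  mem i j := hV.mem (f i) j
  label_eq i j := hV.label_eq (f i) j

theorem dotProduct_star_row {V : Matrix m n ℂ} (hV : IsLabeledIsometry K a b V) (i i' : m) :
    V i ⬝ᵥ star (V i') = (1 : Matrix m m ℂ) i i' :=
  congrFun₂ hV.mul_conjTranspose i i'

theorem vecMul_dotProduct_star_vecMul [Fintype m] {V : Matrix m n ℂ}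
    (hV : IsLabeledIsometry K a b V) (x y : m → ℂ) :
    (x ᵥ* V) ⬝ᵥ star (y ᵥ* V) = x ⬝ᵥ star y := by
  rw [star_vecMul, dotProduct_mulVec, vecMul_vecMul, hV.mul_conjTranspose, vecMul_one]

theorem exists_row_ne_zero {D : Matrix m n ℂ} (hD : IsLabeledIsometry K a b D) (i : m) :
    ∃ j, D i j ≠ 0 := by
  have h : D i ⬝ᵥ star (D i) ≠ 0 := by rw [hD.dotProduct_star_row, one_apply_eq]; exact one_ne_zero
  obtain ⟨j, -, hj⟩ := Finset.exists_ne_zero_of_sum_ne_zero h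
  exact ⟨j, left_ne_zero_of_mul hj⟩

end IsLabeledIsometry

theorem sub_dotProduct_star_sub_self {u w : n → ℂ} (hu : u ⬝ᵥ star u = 1) (hw : w ⬝ᵥ star w = 1) :
    (u - w) ⬝ᵥ star (u - w) = (1 - u ⬝ᵥ star w) + star (1 - u ⬝ᵥ star w) := by
  rw [star_sub, sub_dotProduct, dotProduct_sub, dotProduct_sub, hu, hw, dotProduct_star w u,
    star_sub, star_one]
  ring

theorem eq_of_dotProduct_star_eq_one {u w : n → ℂ} (hu : u ⬝ᵥ star u = 1) (hw : w ⬝ᵥ star w = 1)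
    (huw : u ⬝ᵥ star w = 1) : u = w := by
  have h := sub_dotProduct_star_sub_self hu hw
  rw [huw, sub_self, star_zero, add_zero, dotProduct_self_star_eq_zero] at h
  exact sub_eq_zero.1 h

variable [DecidableEq n]

/-- For unit vectors `u` and `w`, the unitary matrix that maps the row vector `u` to `w` and fixes
the orthogonal complement of `u` and `w`. It is a complex variant of the Householder reflection
along `u - w`. If `u ⬝ᵥ star w = 1` then `u = w`, and the matrix is `1` since `0⁻¹ = 0`. -/
def rotationTo (u w : n → ℂ) : Matrix n n ℂ :=
  1 - (1 - u ⬝ᵥ star w)⁻¹ • vecMulVec (star (u - w)) (u - w)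

theorem vecMul_rotationTo (u w x : n → ℂ) :
    x ᵥ* rotationTo u w = x - ((1 - u ⬝ᵥ star w)⁻¹ * (x ⬝ᵥ star (u - w))) • (u - w) := by
  rw [rotationTo, vecMul_sub, vecMul_one, vecMul_smul, vecMul_vecMulVec, smul_smul]

theorem vecMul_rotationTo_of_orthogonal {u w x : n → ℂ} (hu : x ⬝ᵥ star u = 0)
    (hw : x ⬝ᵥ star w = 0) : x ᵥ* rotationTo u w = x := by
  rw [vecMul_rotationTo, star_sub, dotProduct_sub, hu, hw, sub_zero, mul_zero, zero_smul, sub_zero]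

theorem vecMul_rotationTo_self {u w : n → ℂ} (hu : u ⬝ᵥ star u = 1) (hw : w ⬝ᵥ star w = 1) :
    u ᵥ* rotationTo u w = w := by
  rw [vecMul_rotationTo, star_sub, dotProduct_sub, hu]
  by_cases h : u ⬝ᵥ star w = 1
  · rw [eq_of_dotProduct_star_eq_one hu hw h, sub_self, smul_zero, sub_zero]
  · rw [inv_mul_cancel₀ (sub_ne_zero.2 (Ne.symm h)), one_smul, sub_sub_cancel]

theorem rotationTo_mul_conjTranspose {u w : n → ℂ} (hu : u ⬝ᵥ star u = 1)
    (hw : w ⬝ᵥ star w = 1) : rotationTo u w * (rotationTo u w)ᴴ = 1 := by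
  by_cases huw : u ⬝ᵥ star w = 1
  · simp [rotationTo, huw]
  set c := 1 - u ⬝ᵥ star w
  set A := vecMulVec (star (u - w)) (u - w) with hA
  have hc₀ : c ≠ 0 := sub_ne_zero.2 (Ne.symm huw)
  have hAA : A * A = (c + star c) • A := by
    rw [hA, vecMulVec_mul_vecMulVec, sub_dotProduct_star_sub_self hu hw, vecMulVec_smul]
  have hAH : Aᴴ = A := by rw [hA, conjTranspose_vecMulVec, star_star]
  have hinv : c⁻¹ * (star c)⁻¹ * (c + star c) = c⁻¹ + (star c)⁻¹ := by
    have := star_ne_zero.2 hc₀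
    field_simp
    ring
  rw [rotationTo, conjTranspose_sub, conjTranspose_one, conjTranspose_smul, hAH, star_inv₀,
    sub_mul, mul_sub, mul_sub, one_mul, one_mul, mul_one, smul_mul_smul_comm, hAA, smul_smul, hinv,
    add_smul]
  abel

theorem isLabeledIsometry_rotationTo (hK : IsAdmissibleField K) {u w : n → ℂ}
    (hu : u ⬝ᵥ star u = 1) (hw : w ⬝ᵥ star w = 1) (huK : ∀ j, u j ∈ K) (hwK : ∀ j, w j ∈ K)
    {c : α} (hub : ∀ j, u j ≠ 0 → b j = c) (hwb : ∀ j, w j ≠ 0 → b j = c) :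
    IsLabeledIsometry K b b (rotationTo u w) where
  mul_conjTranspose := rotationTo_mul_conjTranspose hu hw
  mem i j := by
    have hsub : ∀ l, (u - w) l ∈ K := fun l => K.sub_mem (huK l) (hwK l)
    have hdot : u ⬝ᵥ star w ∈ K :=
      K.sum_mem fun l _ => K.mul_mem (huK l) (hK.star_mem (hwK l))
    exact K.sub_mem (IsLabeledIsometry.one.mem (b := b) i j)
      (K.mul_mem (K.inv_mem (K.sub_mem K.one_mem hdot))
        (K.mul_mem (hK.star_mem (hsub i)) (hsub j)))
  label_eq i j h := by
    have hsupp : ∀ l, (u - w) l ≠ 0 → b l = c := fun l hl => by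
      by_contra hbl
      exact hl (by rw [Pi.sub_apply, not_imp_comm.1 (hub l) hbl, not_imp_comm.1 (hwb l) hbl,
        sub_zero])
    by_contra hij
    have hne : (u - w) i ≠ 0 ∧ (u - w) j ≠ 0 := by
      by_contra! hvv
      refine h ?_
      rw [rotationTo, Matrix.sub_apply, one_apply_ne (fun e => hij (congrArg b e)),
        Matrix.smul_apply, vecMulVec_apply, Pi.star_apply]
      by_cases hi : (u - w) i = 0
      · simp [hi]
      · simp [hvv hi]
    exact hij ((hsupp i hne.1).trans (hsupp j hne.2).symm)

namespace IsLabeledIsometry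

variable [DecidableEq m] {D : Matrix m n ℂ}

theorem exists_mul_apply_eq_single (hK : IsAdmissibleField K) (hD : IsLabeledIsometry K a b D)
    (i : m) : ∃ R : Matrix n n ℂ, IsLabeledIsometry K b b R ∧ (∃ j, (D * R) i = Pi.single j 1) ∧
      ∀ i' j, i' ≠ i → D i' = Pi.single j 1 → (D * R) i' = D i' := by
  obtain ⟨j, hj⟩ := hD.exists_row_ne_zero i
  have hu : D i ⬝ᵥ star (D i) = 1 := by rw [hD.dotProduct_star_row, one_apply_eq]
  have hw : Pi.single j 1 ⬝ᵥ star (Pi.single j 1 : n → ℂ) = 1 := by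
    rw [single_one_dotProduct, Pi.star_apply, Pi.single_eq_same, star_one]
  refine ⟨rotationTo (D i) (Pi.single j 1),
    isLabeledIsometry_rotationTo hK hu hw (hD.mem i) (fun l => ?_)
      (fun l hl => (hD.label_eq i l hl).symm) (fun l hl => ?_),
    ⟨j, by rw [mul_apply_eq_vecMul, vecMul_rotationTo_self hu hw]⟩, fun i' j' hi' hDi' => ?_⟩
  · rw [Pi.single_apply]
    split_ifs
    exacts [K.one_mem, K.zero_mem]
  · rw [not_imp_comm.1 (Pi.single_eq_of_ne · 1) hl, hD.label_eq i j hj]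
  · have horth : D i' ⬝ᵥ star (D i) = 0 := by rw [hD.dotProduct_star_row, one_apply_ne hi']
    refine vecMul_rotationTo_of_orthogonal horth ?_
    have hne : j' ≠ j := by
      rintro rfl
      rw [hDi', single_one_dotProduct, Pi.star_apply, star_eq_zero] at horth
      exact hj horth
    rw [hDi', single_one_dotProduct, Pi.star_apply, Pi.single_eq_of_ne hne, star_zero]

theorem exists_mul_rows_eq_single (hK : IsAdmissibleField K) (hD : IsLabeledIsometry K a b D)
    (t : Finset m) : ∃ W : Matrix n n ℂ, IsLabeledIsometry K b b W ∧
      ∀ i ∈ t, ∃ j, (D * W) i = Pi.single j 1 := by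
  induction t using Finset.induction_on with
  | empty => exact ⟨1, .one, by simp⟩
  | insert i t hi ih =>
    obtain ⟨W, hW, hWt⟩ := ih
    obtain ⟨R, hR, hRi, hRt⟩ := (hD.mul hW).exists_mul_apply_eq_single hK i
    refine ⟨W * R, hW.mul hR, fun i' hi' => ?_⟩
    rw [← Matrix.mul_assoc]
    obtain rfl | hi't := Finset.mem_insert.1 hi'
    · exact hRi
    · obtain ⟨j, hj⟩ := hWt i' hi't
      exact ⟨j, by rw [hRt i' j (fun e => hi (e ▸ hi't)) hj, hj]⟩

theorem exists_mul_eq_single_embedding [Finite m] (hK : IsAdmissibleField K)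
    (hD : IsLabeledIsometry K a b D) : ∃ (W : Matrix n n ℂ) (f : m ↪ n),
      IsLabeledIsometry K b b W ∧ (∀ i, (D * W) i = Pi.single (f i) 1) ∧ ∀ i, b (f i) = a i := by
  have := Fintype.ofFinite m
  obtain ⟨W, hW, hrow⟩ := hD.exists_mul_rows_eq_single hK Finset.univ
  choose f hf using fun i => hrow i (Finset.mem_univ i)
  have hDW := hD.mul hW
  refine ⟨W, ⟨f, fun i i' hii' => ?_⟩, hW, hf, fun i => (hDW.label_eq i (f i) ?_).symm⟩
  · by_contra hne
    have h := hDW.dotProduct_star_row i i'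
    rw [hf, hf, hii', one_apply_ne hne, single_one_dotProduct, Pi.star_apply, Pi.single_eq_same,
      star_one] at h
    exact one_ne_zero h
  · rw [hf, Pi.single_eq_same]
    exact one_ne_zero

theorem exists_extension [Finite m] (hK : IsAdmissibleField K)
    (hD : IsLabeledIsometry K a b D) (g : m ↪ n) : ∃ (V : Matrix n n ℂ) (c : n → α),
      IsLabeledIsometry K c b V ∧ (∀ i, V (g i) = D i) ∧ ∀ i, c (g i) = a i := by
  obtain ⟨W, f, hW, hDW, hbf⟩ := hD.exists_mul_eq_single_embedding hK
  obtain ⟨π, hπ⟩ := Equiv.Perm.exists_extending_pair g f g.injective f.injective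
  refine ⟨Wᴴ.submatrix π id, b ∘ π, (hW.conjTranspose hK).submatrix_left π.injective,
    fun i => ?_, fun i => by rw [Function.comp_apply, hπ, hbf]⟩
  calc Wᴴ.submatrix π id (g i) = Pi.single (f i) 1 ᵥ* Wᴴ := by
        rw [single_one_vecMul, ← hπ]; rfl
    _ = (D * W * Wᴴ) i := by rw [← hDW, mul_apply_eq_vecMul (D * W)]
    _ = D i := by rw [Matrix.mul_assoc, hW.mul_conjTranspose, Matrix.mul_one]

end IsLabeledIsometry

end Unitary

/-! ### Isotropic vectors -/

section Isotropic

open scoped ComplexOrder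

variable {K : Subfield ℂ} {n : Type*} {σ : n → SymType} {x : n → ℂ}

/-- The part of `x` on the coordinates at which `σ` has sign `ε`. -/
def signPart (σ : n → SymType) (x : n → ℂ) (ε : ℤˣ) : n → ℂ :=
  fun j => if (σ j).sign = ε then x j else 0

theorem signPart_one_add_signPart_neg_one (σ : n → SymType) (x : n → ℂ) :
    signPart σ x 1 + signPart σ x (-1) = x := by
  ext j
  obtain h | h := Int.units_eq_one_or (σ j).sign <;> simp [signPart, h]

variable [Fintype n]

/-- The indefinite Hermitian form `∑ ε_j y_j conj(x_j)`, where `ε_j` are the signs of `σ`. -/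
def signedInner (σ : n → SymType) (y x : n → ℂ) : ℂ :=
  ∑ j, ((σ j).sign : ℤ) * (y j * star (x j))

theorem signPart_dotProduct_star_signPart (σ : n → SymType) (x y : n → ℂ) {ε ε' : ℤˣ}
    (h : ε ≠ ε') : signPart σ x ε ⬝ᵥ star (signPart σ y ε') = 0 :=
  Finset.sum_eq_zero fun j _ => by
    by_cases hj : (σ j).sign = ε
    · simp [signPart, hj, h]
    · simp [signPart, hj]

theorem signedInner_eq_sub (σ : n → SymType) (y x : n → ℂ) :
    signedInner σ y x = y ⬝ᵥ star (signPart σ x 1) - y ⬝ᵥ star (signPart σ x (-1)) := by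
  rw [signedInner, dotProduct, dotProduct, ← Finset.sum_sub_distrib]
  refine Finset.sum_congr rfl fun j _ => ?_
  obtain h | h := Int.units_eq_one_or (σ j).sign <;> simp [signPart, h]

theorem signPart_dotProduct_star_self_eq (hiso : signedInner σ x x = 0) :
    signPart σ x (-1) ⬝ᵥ star (signPart σ x (-1)) = signPart σ x 1 ⬝ᵥ star (signPart σ x 1) := by
  have hdot (ε : ℤˣ) : x ⬝ᵥ star (signPart σ x ε) = signPart σ x ε ⬝ᵥ star (signPart σ x ε) :=
    Finset.sum_congr rfl fun j _ => by by_cases h : (σ j).sign = ε <;> simp [signPart, h]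
  rw [signedInner_eq_sub, hdot, hdot, sub_eq_zero] at hiso
  exact hiso.symm

theorem exists_dotProduct_star_self_eq_sq (hK : IsAdmissibleField K) {w : n → ℂ} (hw : w ≠ 0)
    (hwK : ∀ j, w j ∈ K) : ∃ ρ : ℝ, ρ ≠ 0 ∧ (ρ : ℂ) ∈ K ∧ w ⬝ᵥ star w = (ρ : ℂ) ^ 2 := by
  have hre : w ⬝ᵥ star w = ((w ⬝ᵥ star w).re : ℂ) :=
    Complex.eq_re_of_ofReal_le (r := 0) (by simp)
  have hpos : 0 < (w ⬝ᵥ star w).re :=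
    Complex.zero_lt_real.1 (hre ▸ dotProduct_self_star_pos_iff.2 hw)
  refine ⟨√(w ⬝ᵥ star w).re, (Real.sqrt_pos.2 hpos).ne', hK.2 _ hpos ?_, ?_⟩
  · rw [← hre]
    exact K.sum_mem fun j _ => K.mul_mem (hwK j) (hK.star_mem (hwK j))
  · rw [← Complex.ofReal_pow, Real.sq_sqrt hpos.le, ← hre]

theorem exists_isLabeledIsometry_signPart (hK : IsAdmissibleField K) (hx : x ≠ 0)
    (hxK : ∀ j, x j ∈ K) {e : ℤ} (hxe : ∀ j, x j ≠ 0 → (σ j).exp = e)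
    (hiso : signedInner σ x x = 0) :
    ∃ ρ : ℝ, ρ ≠ 0 ∧ IsLabeledIsometry K (fun ε : ℤˣ => (⟨ε, e⟩ : SymType)) σ
      (Matrix.of fun ε => (ρ : ℂ)⁻¹ • signPart σ x ε) := by
  have hpartK (ε : ℤˣ) (j) : signPart σ x ε j ∈ K := by
    unfold signPart; split_ifs; exacts [hxK j, K.zero_mem]
  have hnorm := signPart_dotProduct_star_self_eq hiso
  have h1 : signPart σ x 1 ≠ 0 := fun h => hx <| by
    rw [h, zero_dotProduct, dotProduct_self_star_eq_zero] at hnorm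
    rw [← signPart_one_add_signPart_neg_one σ x, h, hnorm, add_zero]
  obtain ⟨ρ, hρ, hρK, hρx⟩ := exists_dotProduct_star_self_eq_sq hK h1 (hpartK 1)
  have hself (ε : ℤˣ) : signPart σ x ε ⬝ᵥ star (signPart σ x ε) = (ρ : ℂ) ^ 2 := by
    obtain rfl | rfl := Int.units_eq_one_or ε
    exacts [hρx, hnorm.trans hρx]
  have hρ' : (ρ : ℂ) ≠ 0 := Complex.ofReal_ne_zero.2 hρ
  refine ⟨ρ, hρ, ?_, fun ε j => K.mul_mem (K.inv_mem hρK) (hpartK ε j), fun ε j h => ?_⟩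
  · ext ε ε'
    change ((ρ : ℂ)⁻¹ • signPart σ x ε) ⬝ᵥ star ((ρ : ℂ)⁻¹ • signPart σ x ε') = _
    have hstar : star (ρ : ℂ)⁻¹ = (ρ : ℂ)⁻¹ :=
      (star_inv₀ _).trans (congrArg _ (Complex.conj_ofReal ρ))
    rw [star_smul, smul_dotProduct, dotProduct_smul, hstar]
    obtain rfl | h := eq_or_ne ε ε'
    · rw [hself, one_apply_eq, smul_eq_mul, smul_eq_mul]
      field_simp
    · rw [signPart_dotProduct_star_signPart σ x x h, smul_zero, smul_zero, one_apply_ne h]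
  · have hj : signPart σ x ε j ≠ 0 := right_ne_zero_of_mul h
    simp only [signPart, ne_eq, ite_eq_right_iff, Classical.not_imp] at hj
    rw [← hj.1, ← hxe j hj.2]

theorem exists_isLabeledIsometry_vecMul_isotropic [DecidableEq n] (hK : IsAdmissibleField K)
    (hx : x ≠ 0) (hxK : ∀ j, x j ∈ K) {e : ℤ} (hxe : ∀ j, x j ≠ 0 → (σ j).exp = e)
    (hiso : signedInner σ x x = 0) :
    ∃ (V : Matrix n n ℂ) (ρ : ℂ) (p q : n), IsLabeledIsometry K σ σ V ∧ ρ ≠ 0 ∧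
      σ p = ⟨1, e⟩ ∧ σ q = ⟨-1, e⟩ ∧ x ᵥ* V = ρ • (Pi.single p 1 + Pi.single q 1) ∧
      ∀ y, signedInner σ y x = 0 → (y ᵥ* V) p = (y ᵥ* V) q := by
  obtain ⟨ρ, hρ, hD⟩ := exists_isLabeledIsometry_signPart hK hx hxK hxe hiso
  obtain ⟨V, f, hV, hDV, hf⟩ := hD.exists_mul_eq_single_embedding hK
  have hpart (ε : ℤˣ) : ((ρ : ℂ)⁻¹ • signPart σ x ε) ᵥ* V = Pi.single (f ε) 1 := hDV ε
  have hcoord (y : n → ℂ) (ε : ℤˣ) :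
      (y ᵥ* V) (f ε) = star (ρ : ℂ)⁻¹ * (y ⬝ᵥ star (signPart σ x ε)) := by
    rw [← smul_eq_mul, ← dotProduct_smul, ← star_smul, ← hV.vecMul_dotProduct_star_vecMul,
      hpart, ← Pi.single_star, star_one, dotProduct_single_one]
  have hρ' : (ρ : ℂ) ≠ 0 := Complex.ofReal_ne_zero.2 hρ
  refine ⟨V, ρ, f 1, f (-1), hV, hρ', hf 1, hf (-1), ?_, fun y hy => ?_⟩
  · rw [← hpart, ← hpart, ← add_vecMul, ← smul_add, signPart_one_add_signPart_neg_one,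
      smul_vecMul, smul_smul, mul_inv_cancel₀ hρ', one_smul]
  · rw [signedInner_eq_sub, sub_eq_zero] at hy
    rw [hcoord, hcoord, hy]

end Isotropic

/-! ### Matrices of Laurent polynomials -/

section Coefficients

variable {R : Type*} [Semiring R]

theorem coeff_mul_eq_sum (p q : R[T;T⁻¹]) (n : ℤ) :
    (p * q).coeff n = ∑ k ∈ p.coeff.support, p.coeff k * q.coeff (n - k) := by
  rw [AddMonoidAlgebra.coeff_mul_apply_left, Finsupp.sum]
  exact Finset.sum_congr rfl fun k _ => by rw [neg_add_eq_sub]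

theorem coeff_T_mul (p : R[T;T⁻¹]) (m n : ℤ) : (T m * p).coeff n = p.coeff (n - m) := by
  rw [T, AddMonoidAlgebra.coeff_single_mul_apply, one_mul, neg_add_eq_sub]

theorem coeff_C_mul (a : R) (p : R[T;T⁻¹]) (n : ℤ) : (C a * p).coeff n = a * p.coeff n := by
  rw [← single_eq_C, AddMonoidAlgebra.coeff_single_mul_apply, neg_zero, zero_add]

theorem coeff_mul_C (a : R) (p : R[T;T⁻¹]) (n : ℤ) : (p * C a).coeff n = p.coeff n * a := by
  rw [← single_eq_C, AddMonoidAlgebra.coeff_mul_single_apply, neg_zero, add_zero]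

theorem coeff_mul_T (p : R[T;T⁻¹]) (m n : ℤ) : (p * T m).coeff n = p.coeff (n - m) := by
  rw [T, AddMonoidAlgebra.coeff_mul_single_apply, mul_one, sub_eq_add_neg]

theorem coeff_add_apply (p q : R[T;T⁻¹]) (n : ℤ) : (p + q).coeff n = p.coeff n + q.coeff n :=
  rfl

theorem coeff_sub_apply {R : Type*} [Ring R] (p q : R[T;T⁻¹]) (n : ℤ) :
    (p - q).coeff n = p.coeff n - q.coeff n :=
  rfl

theorem coeff_sum_apply {ι : Type*} (s : Finset ι) (f : ι → R[T;T⁻¹]) (n : ℤ) :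
    (∑ i ∈ s, f i).coeff n = ∑ i ∈ s, (f i).coeff n := by
  rw [AddMonoidAlgebra.coeff_sum, Finsupp.finsetSum_apply]

theorem coeff_one_of_ne_zero {n : ℤ} (hn : n ≠ 0) : (1 : R[T;T⁻¹]).coeff n = 0 := by
  rw [← map_one C, C_apply, if_neg hn]

end Coefficients

variable {K : Subfield ℂ} {r s t : ℕ}

section Involution

/-- The involution `p ↦ p*` as a ring homomorphism. -/
def pstarHom : ℂ[T;T⁻¹] →+* ℂ[T;T⁻¹] :=
  ((invert (R := ℂ)) : ℂ[T;T⁻¹] →+* ℂ[T;T⁻¹]).comp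
    (AddMonoidAlgebra.mapRingHom ℤ (starRingEnd ℂ))

theorem pstar_eq_pstarHom : pstar = pstarHom := rfl

theorem coeff_pstar (p : ℂ[T;T⁻¹]) (n : ℤ) : (pstar p).coeff n = star (p.coeff (-n)) := by
  rw [pstar, invert_apply, AddMonoidAlgebra.coeff_mapRingHom, starRingEnd_apply]

theorem pstar_pstar (p : ℂ[T;T⁻¹]) : pstar (pstar p) = p := by
  ext n
  rw [coeff_pstar, coeff_pstar, neg_neg, star_star]

theorem pstar_T (n : ℤ) : pstar (T n) = T (-n) := by
  ext k
  rw [coeff_pstar, T_apply, T_apply, apply_ite star, star_one, star_zero]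
  simp only [neg_eq_iff_eq_neg]

theorem pstar_C (a : ℂ) : pstar (C a) = C (star a) := by
  ext k
  rw [coeff_pstar, C_apply, C_apply, apply_ite star, star_zero]
  simp only [neg_eq_zero]

theorem mstar_eq_transpose_map (M : LMat r s) : mstar M = (M.map pstarHom)ᵀ := rfl

theorem mstar_mul (M : LMat r s) (N : LMat s t) : mstar (M * N) = mstar N * mstar M := by
  simp only [mstar_eq_transpose_map, Matrix.map_mul, transpose_mul]

theorem mstar_mstar (M : LMat r s) : mstar (mstar M) = M :=
  Matrix.ext fun _ _ => pstar_pstar _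

theorem mstar_one : mstar (1 : LMat s s) = 1 := by
  rw [mstar_eq_transpose_map, Matrix.map_one _ (map_zero _) (map_one _), transpose_one]

theorem mstar_map_C (V : Matrix (Fin r) (Fin s) ℂ) : mstar (V.map C) = Vᴴ.map C :=
  Matrix.ext fun _ _ => pstar_C _

end Involution

namespace IsParaunitary

theorem mul_mstar_self {M : LMat r s} (hM : IsParaunitary M) : M * mstar M = 1 := hM

theorem mstar_mul_self {M : LMat s s} (hM : IsParaunitary M) : mstar M * M = 1 :=
  mul_eq_one_comm.1 hM

protected theorem one : IsParaunitary (1 : LMat s s) := by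
  rw [IsParaunitary, mstar_one, one_mul]

protected theorem mstar {M : LMat s s} (hM : IsParaunitary M) : IsParaunitary (mstar M) := by
  rw [IsParaunitary, mstar_mstar]
  exact hM.mstar_mul_self

protected theorem mul {M : LMat r s} {N : LMat s t} (hM : IsParaunitary M)
    (hN : IsParaunitary N) : IsParaunitary (M * N) := by
  rw [IsParaunitary, mstar_mul, Matrix.mul_assoc, ← Matrix.mul_assoc N, hN.mul_mstar_self,
    Matrix.one_mul, hM.mul_mstar_self]

end IsParaunitary

/-- The Laurent polynomials with coefficients in `K`. -/
def laurentSubring (K : Subfield ℂ) : Subring ℂ[T;T⁻¹] where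
  carrier := {p | ∀ k, p.coeff k ∈ K}
  zero_mem' _ := K.zero_mem
  one_mem' k := by
    by_cases hk : k = 0
    · rw [hk, ← map_one C, C_apply, if_pos rfl]
      exact K.one_mem
    · rw [coeff_one_of_ne_zero hk]
      exact K.zero_mem
  add_mem' hp hq k := K.add_mem (hp k) (hq k)
  neg_mem' hp k := K.neg_mem (hp k)
  mul_mem' hp hq k := by
    rw [coeff_mul_eq_sum]
    exact K.sum_mem fun l _ => K.mul_mem (hp _) (hq _)

theorem C_mem_laurentSubring {x : ℂ} (hx : x ∈ K) : C x ∈ laurentSubring K := fun k => by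
  rw [C_apply]
  split_ifs
  exacts [hx, K.zero_mem]

theorem T_mem_laurentSubring (n : ℤ) : T n ∈ laurentSubring K := fun k => by
  rw [T_apply]
  split_ifs
  exacts [K.one_mem, K.zero_mem]

namespace HasCoeffsIn

theorem mem_laurentSubring {M : LMat r s} (hM : HasCoeffsIn K M) (i : Fin r) (j : Fin s) :
    M i j ∈ laurentSubring K :=
  hM i j

protected theorem mul {M : LMat r s} {N : LMat s t} (hM : HasCoeffsIn K M)
    (hN : HasCoeffsIn K N) : HasCoeffsIn K (M * N) := fun i j =>
  (laurentSubring K).sum_mem fun l _ =>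
    (laurentSubring K).mul_mem (hM.mem_laurentSubring i l) (hN.mem_laurentSubring l j)

protected theorem mstar (hK : IsAdmissibleField K) {M : LMat r s} (hM : HasCoeffsIn K M) :
    HasCoeffsIn K (mstar M) := fun i j k => by
  rw [SymExt.mstar, coeff_pstar]
  exact hK.star_mem (hM j i (-k))

end HasCoeffsIn

theorem sign_mul_self (ε : ℤˣ) : ((ε : ℤ) : ℂ) * ((ε : ℤ) : ℂ) = 1 := by
  rw [← Int.cast_mul, ← Units.val_mul, Int.units_mul_self, Units.val_one, Int.cast_one]

theorem hasSym_iff (p : ℂ[T;T⁻¹]) (σ : SymType) :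
    HasSym p σ ↔ p = C ((σ.sign : ℤ) : ℂ) * (T σ.exp * invert p) := by
  have coeff_rhs (k : ℤ) : (C ((σ.sign : ℤ) : ℂ) * (T σ.exp * invert p)).coeff k
      = ((σ.sign : ℤ) : ℂ) * p.coeff (σ.exp - k) := by
    rw [coeff_C_mul, coeff_T_mul, invert_apply, neg_sub]
  constructor
  · intro h
    ext k
    rw [coeff_rhs, h k, ← mul_assoc, sign_mul_self, one_mul]
  · intro h k
    conv_lhs => rw [h]
    rw [coeff_rhs, sub_sub_cancel]

namespace HasSym

variable {p q : ℂ[T;T⁻¹]} {σ τ : SymType}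

protected theorem zero (σ : SymType) : HasSym 0 σ := fun _ => (mul_zero _).symm

protected theorem add (hp : HasSym p σ) (hq : HasSym q σ) : HasSym (p + q) σ := fun k =>
  (congrArg₂ (· + ·) (hp k) (hq k)).trans (mul_add _ _ _).symm

protected theorem sum {ι : Type*} {f : ι → ℂ[T;T⁻¹]} (s : Finset ι) (h : ∀ i, HasSym (f i) σ) :
    HasSym (∑ i ∈ s, f i) σ :=
  Finset.sum_induction f (HasSym · σ) (fun _ _ => .add) (.zero σ) fun i _ => h i

protected theorem mul (hp : HasSym p σ) (hq : HasSym q τ) :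
    HasSym (p * q) ⟨σ.sign * τ.sign, σ.exp + τ.exp⟩ := by
  rw [hasSym_iff] at hp hq ⊢
  conv_lhs => rw [hp, hq]
  simp only [Units.val_mul, Int.cast_mul, map_mul, T_add]
  ring

protected theorem pstar (hp : HasSym p σ) : HasSym (pstar p) ⟨σ.sign, -σ.exp⟩ := fun k => by
  rw [coeff_pstar, coeff_pstar, show -(-σ.exp - k) = σ.exp - -k by ring, hp (-k), star_mul',
    star_intCast]

theorem C (x : ℂ) : HasSym (C x) ⟨1, 0⟩ := by
  rw [hasSym_iff]
  simp

end HasSym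

namespace HasSymMatrix

variable {ρ : Fin r → SymType} {σ : Fin s → SymType} {τ : Fin t → SymType}

protected theorem mul {M : LMat r s} {N : LMat s t} (hM : HasSymMatrix M (starMul ρ σ))
    (hN : HasSymMatrix N (starMul σ τ)) : HasSymMatrix (M * N) (starMul ρ τ) := fun i j => by
  refine .sum _ fun l => ?_
  have sign_mul : (starMul ρ σ i l).sign * (starMul σ τ l j).sign = (starMul ρ τ i j).sign := by
    simp only [starMul]
    rw [mul_assoc, ← mul_assoc (σ l).sign, Int.units_mul_self, one_mul]
  have exp_add : (starMul ρ σ i l).exp + (starMul σ τ l j).exp = (starMul ρ τ i j).exp :=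
    sub_add_sub_cancel' _ _ _
  simpa only [sign_mul, exp_add] using (hM i l).mul (hN l j)

protected theorem mstar {M : LMat r s} (hM : HasSymMatrix M (starMul ρ σ)) :
    HasSymMatrix (mstar M) (starMul σ ρ) := fun j i => by
  rw [SymExt.mstar]
  simpa only [starMul, mul_comm, neg_sub] using (hM i j).pstar

end HasSymMatrix

theorem IsLabeledIsometry.hasSymMatrix_map_C {ρ : Fin r → SymType} {σ : Fin s → SymType}
    {V : Matrix (Fin r) (Fin s) ℂ} (hV : IsLabeledIsometry K ρ σ V) :
    HasSymMatrix (V.map C) (starMul ρ σ) := fun i j => by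
  rw [map_apply]
  by_cases hij : V i j = 0
  · rw [hij, map_zero]
    exact .zero _
  · simpa only [starMul, hV.label_eq i j hij, Int.units_mul_self, sub_self] using HasSym.C (V i j)

/-- A matrix over `K` with `M M* = 1` and with symmetry pattern `ρ* σ`: the matrices that are to
be factored, and all factors, are of this kind. -/
structure IsSymParaunitary (K : Subfield ℂ) (ρ : Fin r → SymType) (σ : Fin s → SymType)
    (M : LMat r s) : Prop where
  paraunitary : IsParaunitary M
  coeffs : HasCoeffsIn K M
  symm : HasSymMatrix M (starMul ρ σ)

theorem IsLabeledIsometry.isSymParaunitary_map_C {ρ : Fin r → SymType} {σ : Fin s → SymType}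
    {V : Matrix (Fin r) (Fin s) ℂ} (hV : IsLabeledIsometry K ρ σ V) :
    IsSymParaunitary K ρ σ (V.map C) where
  paraunitary := by
    rw [IsParaunitary, mstar_map_C, ← Matrix.map_mul, hV.mul_conjTranspose,
      Matrix.map_one _ (map_zero _) (map_one _)]
  coeffs i j := C_mem_laurentSubring (hV.mem i j)
  symm := hV.hasSymMatrix_map_C

namespace IsSymParaunitary

variable {ρ : Fin r → SymType} {σ : Fin s → SymType} {τ : Fin t → SymType}

protected theorem one : IsSymParaunitary K σ σ 1 := by
  simpa only [Matrix.map_one _ (map_zero C) (map_one C)] using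
    (IsLabeledIsometry.one (K := K) (b := σ)).isSymParaunitary_map_C

protected theorem mul {M : LMat r s} {N : LMat s t} (hM : IsSymParaunitary K ρ σ M)
    (hN : IsSymParaunitary K σ τ N) : IsSymParaunitary K ρ τ (M * N) where
  paraunitary := hM.paraunitary.mul hN.paraunitary
  coeffs := hM.coeffs.mul hN.coeffs
  symm := hM.symm.mul hN.symm

protected theorem mstar (hK : IsAdmissibleField K) {ρ : Fin s → SymType} {M : LMat s s}
    (hM : IsSymParaunitary K ρ σ M) : IsSymParaunitary K σ ρ (mstar M) where
  paraunitary := hM.paraunitary.mstar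
  coeffs := hM.coeffs.mstar hK
  symm := hM.symm.mstar

end IsSymParaunitary

/-! ### Centering the symmetric entries -/

section Centering

/-- The substitution `z = w²`. -/
def doubling : ℂ[T;T⁻¹] →+* ℂ[T;T⁻¹] :=
  AddMonoidAlgebra.mapDomainRingHom ℂ (AddMonoidHom.mulLeft (2 : ℤ))

theorem coeff_doubling_two_mul (p : ℂ[T;T⁻¹]) (k : ℤ) : (doubling p).coeff (2 * k) = p.coeff k :=
  Finsupp.mapDomain_apply (mul_right_injective₀ two_ne_zero) p.coeff k

theorem coeff_doubling_of_not_dvd (p : ℂ[T;T⁻¹]) {n : ℤ} (hn : ¬ 2 ∣ n) :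
    (doubling p).coeff n = 0 :=
  Finsupp.mapDomain_of_notMem_range _ _ fun ⟨k, hk⟩ => hn ⟨k, hk.symm⟩

theorem doubling_T (n : ℤ) : doubling (T n) = T (2 * n) :=
  AddMonoidAlgebra.mapDomain_single

theorem doubling_C (x : ℂ) : doubling (C x) = C x :=
  AddMonoidAlgebra.mapDomain_single

theorem doubling_pstar (p : ℂ[T;T⁻¹]) : doubling (pstar p) = pstar (doubling p) := by
  ext n
  by_cases hn : 2 ∣ n
  · obtain ⟨k, rfl⟩ := hn
    rw [coeff_pstar, coeff_doubling_two_mul, ← mul_neg, coeff_doubling_two_mul, coeff_pstar]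
  · rw [coeff_pstar, coeff_doubling_of_not_dvd _ hn, coeff_doubling_of_not_dvd _ (by omega),
      star_zero]

variable {ρ : Fin r → SymType} {σ : Fin s → SymType} {τ : Fin t → SymType}

/-- The substitution `z = w²`, followed by a shift that moves the centre of symmetry of every
entry of a matrix with pattern `starMul ρ σ` to `0`. -/
def centered (ρ : Fin r → SymType) (σ : Fin s → SymType) (M : LMat r s) : LMat r s :=
  fun i j => T ((ρ i).exp - (σ j).exp) * doubling (M i j)

theorem centered_one : centered σ σ 1 = 1 := by
  ext1 i j
  rw [centered]
  obtain rfl | hij := eq_or_ne i j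
  · rw [one_apply_eq, sub_self, T_zero, one_mul, map_one]
  · rw [one_apply_ne hij, map_zero, mul_zero]

theorem centered_mul (M : LMat r s) (N : LMat s t) :
    centered ρ τ (M * N) = centered ρ σ M * centered σ τ N := by
  ext1 i j
  rw [centered, Matrix.mul_apply, Matrix.mul_apply, map_sum, Finset.mul_sum]
  refine Finset.sum_congr rfl fun l _ => ?_
  rw [centered, centered, map_mul, ← sub_add_sub_cancel _ (σ l).exp, T_add]
  ring

theorem centered_mstar (M : LMat r s) : centered σ ρ (mstar M) = mstar (centered ρ σ M) := by
  ext1 i j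
  rw [centered, mstar, mstar, centered, pstar_eq_pstarHom, map_mul, ← pstar_eq_pstarHom,
    pstar_T, neg_sub, doubling_pstar]

theorem IsLabeledIsometry.centered_map_C {V : Matrix (Fin r) (Fin s) ℂ}
    (hV : IsLabeledIsometry K ρ σ V) : centered ρ σ (V.map C) = V.map C := by
  ext1 i j
  rw [centered, map_apply, doubling_C]
  by_cases hij : V i j = 0
  · rw [hij, map_zero, mul_zero]
  · rw [hV.label_eq i j hij, sub_self, T_zero, one_mul]

theorem coeff_centered (M : LMat r s) (i : Fin r) (j : Fin s) (k : ℤ) :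
    (centered ρ σ M i j).coeff (2 * k + (ρ i).exp - (σ j).exp) = (M i j).coeff k := by
  rw [centered, coeff_T_mul, show 2 * k + (ρ i).exp - (σ j).exp - ((ρ i).exp - (σ j).exp) = 2 * k
    by ring, coeff_doubling_two_mul]

theorem coeff_centered_of_not_dvd (M : LMat r s) {i : Fin r} {j : Fin s} {n : ℤ}
    (hn : ¬ 2 ∣ n + (σ j).exp - (ρ i).exp) : (centered ρ σ M i j).coeff n = 0 := by
  rw [centered, coeff_T_mul, coeff_doubling_of_not_dvd]
  rwa [sub_sub_eq_add_sub]

theorem exists_eq_of_coeff_centered_ne_zero {M : LMat r s} {i : Fin r} {j : Fin s} {n : ℤ}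
    (hn : (centered ρ σ M i j).coeff n ≠ 0) : ∃ k, n = 2 * k + (ρ i).exp - (σ j).exp := by
  obtain ⟨k, hk⟩ := not_imp_comm.1 (coeff_centered_of_not_dvd M) hn
  exact ⟨k, by omega⟩

theorem HasCoeffsIn.centered {M : LMat r s} (hM : HasCoeffsIn K M) :
    HasCoeffsIn K (centered ρ σ M) := fun i j n => by
  by_cases hn : (SymExt.centered ρ σ M i j).coeff n = 0
  · rw [hn]
    exact K.zero_mem
  · obtain ⟨k, rfl⟩ := exists_eq_of_coeff_centered_ne_zero hn
    rw [coeff_centered]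
    exact hM i j k

theorem HasSymMatrix.coeff_centered_neg {M : LMat r s} (hM : HasSymMatrix M (starMul ρ σ))
    (i : Fin r) (j : Fin s) (n : ℤ) :
    (centered ρ σ M i j).coeff (-n)
      = ((ρ i).sign : ℤ) * (((σ j).sign : ℤ) * (centered ρ σ M i j).coeff n) := by
  by_cases hn : 2 ∣ n + (σ j).exp - (ρ i).exp
  · obtain ⟨k, hk⟩ := hn
    have hsymm := hM i j k
    simp only [starMul, Units.val_mul, Int.cast_mul, mul_assoc] at hsymm
    rw [show -n = 2 * ((σ j).exp - (ρ i).exp - k) + (ρ i).exp - (σ j).exp by omega,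
      coeff_centered, hsymm, show n = 2 * k + (ρ i).exp - (σ j).exp by omega, coeff_centered]
  · rw [coeff_centered_of_not_dvd _ hn, coeff_centered_of_not_dvd _ (by omega), mul_zero, mul_zero]

/-- The vector of the coefficients of `w ^ n` in the `i`-th row of `M`. -/
def rowCoeff (M : LMat r s) (i : Fin r) (n : ℤ) : Fin s → ℂ := fun j => (M i j).coeff n

theorem rowCoeff_mul_map_C (M : LMat r s) (V : Matrix (Fin s) (Fin t) ℂ) (i : Fin r) (n : ℤ) :
    rowCoeff (M * V.map C) i n = rowCoeff M i n ᵥ* V := by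
  ext j
  rw [rowCoeff, Matrix.mul_apply, coeff_sum_apply]
  exact Finset.sum_congr rfl fun l _ => coeff_mul_C _ _ _

/-- In the variable `w`, centered as in `centered`, the `i`-th row of `M` has no terms of degree
below `-d`. -/
def RowBound (ρ : Fin r → SymType) (σ : Fin s → SymType) (M : LMat r s) (i : Fin r) (d : ℤ) :
    Prop :=
  ∀ n < -d, rowCoeff (centered ρ σ M) i n = 0

theorem RowBound.mono {M : LMat r s} {i : Fin r} {d d' : ℤ} (hM : RowBound ρ σ M i d)
    (hd : d ≤ d') : RowBound ρ σ M i d' :=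
  fun n hn => hM n (hn.trans_le (neg_le_neg hd))

theorem RowBound.sub_one {M : LMat r s} {i : Fin r} {d : ℤ} (hM : RowBound ρ σ M i d)
    (hd : rowCoeff (centered ρ σ M) i (-d) = 0) : RowBound ρ σ M i (d - 1) := fun n hn => by
  obtain h | rfl := (show n ≤ -d by omega).lt_or_eq
  exacts [hM n h, hd]

theorem rowBound_one (i : Fin s) : RowBound σ σ 1 i 0 := fun n hn => by
  ext j
  rw [centered_one, rowCoeff, one_apply]
  split_ifs
  exacts [coeff_one_of_ne_zero (by omega), rfl]

theorem RowBound.mul_map_C {M : LMat r s} {i : Fin r} {d : ℤ} (hM : RowBound ρ σ M i d)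
    {V : Matrix (Fin s) (Fin t) ℂ} (hV : IsLabeledIsometry K σ τ V) :
    RowBound ρ τ (M * V.map C) i d := fun n hn => by
  rw [centered_mul (σ := σ), hV.centered_map_C, rowCoeff_mul_map_C, hM n hn, zero_vecMul]

/-- Every row of `M` satisfies `RowBound` with the bound `d`; for a matrix with pattern
`starMul ρ σ` this says that its terms have degree between `-d` and `d` in `w`. -/
def HalfDegreeLE (ρ : Fin r → SymType) (σ : Fin s → SymType) (M : LMat r s) (d : ℤ) : Prop :=
  ∀ i, RowBound ρ σ M i d

theorem HalfDegreeLE.bounds {M : LMat r s} {d : ℤ} (hd : HalfDegreeLE ρ σ M d)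
    (hM : HasSymMatrix M (starMul ρ σ)) {i : Fin r} {j : Fin s} {k : ℤ}
    (hk : (M i j).coeff k ≠ 0) :
    -d ≤ 2 * k + (ρ i).exp - (σ j).exp ∧ 2 * k + (ρ i).exp - (σ j).exp ≤ d := by
  rw [← coeff_centered (ρ := ρ) (σ := σ)] at hk
  constructor <;> by_contra! hlt
  · exact hk (congrFun (hd i _ hlt) j)
  · refine hk ?_
    rw [← neg_neg (2 * k + (ρ i).exp - (σ j).exp), hM.coeff_centered_neg,
      show (centered ρ σ M i j).coeff _ = 0 from congrFun (hd i _ (neg_lt_neg hlt)) j,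
      mul_zero, mul_zero]

/-- All exponents of the pattern vector lie in `{0, -1}`. -/
def IsNormalized (σ : Fin s → SymType) : Prop := ∀ j, (σ j).exp = 0 ∨ (σ j).exp = -1

theorem HalfDegreeLE.supportedInUnit {σ' : Fin s → SymType} {M : LMat s s}
    (hd : HalfDegreeLE σ σ' M 2) (hM : HasSymMatrix M (starMul σ σ')) (hσ : IsNormalized σ)
    (hσ' : IsNormalized σ') : SupportedInUnit M := fun i j k hk => by
  have := hd.bounds hM hk
  have := hσ i
  have := hσ' j
  omega

theorem coeff_centered_mul_mstar {N : LMat t s} {M : LMat r s}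
    (hN : HasSymMatrix N (starMul τ σ)) {i : Fin r} {l : Fin t} {d d' : ℤ}
    (hMd : RowBound ρ σ M i d) (hNd : RowBound τ σ N l d') :
    (centered ρ τ (M * mstar N) i l).coeff (-(d + d')) = ((τ l).sign : ℤ) *
      signedInner σ (rowCoeff (centered ρ σ M) i (-d)) (rowCoeff (centered τ σ N) l (-d')) := by
  rw [centered_mul (σ := σ), centered_mstar, Matrix.mul_apply, coeff_sum_apply, signedInner,
    Finset.mul_sum]
  refine Finset.sum_congr rfl fun j _ => ?_
  rw [coeff_mul_eq_sum, Finset.sum_eq_single (-d)]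
  · rw [mstar, coeff_pstar, show -(-(d + d') - -d) = -(-d') by ring, hN.coeff_centered_neg l j,
      star_mul', star_mul', star_intCast, star_intCast, rowCoeff, rowCoeff]
    ring
  · intro k _ hk
    obtain hk | hk := lt_or_gt_of_ne hk
    · rw [show (centered ρ σ M i j).coeff k = 0 from congrFun (hMd k hk) j, zero_mul]
    · rw [mstar, coeff_pstar, hN.coeff_centered_neg l j,
        show (centered τ σ N l j).coeff _ = 0 from congrFun (hNd _ (by omega)) j, mul_zero,
        mul_zero, star_zero, mul_zero]
  · intro h
    rw [Finsupp.notMem_support_iff.1 h, zero_mul]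

theorem signedInner_rowCoeff_eq_zero {N : LMat t s} {M : LMat r s}
    (hN : HasSymMatrix N (starMul τ σ)) {i : Fin r} {l : Fin t} {d d' : ℤ}
    (hMd : RowBound ρ σ M i d) (hNd : RowBound τ σ N l d')
    (h0 : (centered ρ τ (M * mstar N) i l).coeff (-(d + d')) = 0) :
    signedInner σ (rowCoeff (centered ρ σ M) i (-d)) (rowCoeff (centered τ σ N) l (-d')) = 0 := by
  rw [coeff_centered_mul_mstar hN hMd hNd] at h0
  exact (mul_eq_zero.1 h0).resolve_left (left_ne_zero_of_mul_eq_one (sign_mul_self _))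

theorem IsSymParaunitary.signedInner_rowCoeff_eq_zero {M : LMat r s}
    (hM : IsSymParaunitary K ρ σ M) {i l : Fin r} {d d' : ℤ} (hi : RowBound ρ σ M i d)
    (hl : RowBound ρ σ M l d') (hd : 0 < d + d') :
    signedInner σ (rowCoeff (centered ρ σ M) i (-d)) (rowCoeff (centered ρ σ M) l (-d')) = 0 :=
  SymExt.signedInner_rowCoeff_eq_zero hM.symm hi hl <| by
    rw [hM.paraunitary.mul_mstar_self]
    exact congrFun (rowBound_one i _ (by omega)) l

end Centering

/-! ### Butterfly matrices -/

section Butterfly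

/-- The matrix that multiplies `e_p + e_q` by `X` and `e_p - e_q` by `Y` and fixes the other unit
vectors. -/
def butterfly (p q : Fin s) (X Y : ℂ[T;T⁻¹]) : LMat s s := fun i j =>
  if i = j then if i = p ∨ i = q then C (1 / 2) * (X + Y) else 1
  else if (i = p ∧ j = q) ∨ (i = q ∧ j = p) then C (1 / 2) * (X - Y) else 0

variable {p q : Fin s} {X Y : ℂ[T;T⁻¹]}

theorem mul_butterfly_apply_left (hpq : p ≠ q) (M : LMat r s) (i : Fin r) :
    (M * butterfly p q X Y) i p
      = C (1 / 2) * ((M i p + M i q) * X + (M i p - M i q) * Y) := by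
  rw [Matrix.mul_apply, Fintype.sum_eq_add p q hpq fun j hj => by simp [butterfly, hj]]
  simp only [butterfly, hpq.symm, if_true, if_false, true_or, and_self, or_true]
  ring

theorem mul_butterfly_apply_right (hpq : p ≠ q) (M : LMat r s) (i : Fin r) :
    (M * butterfly p q X Y) i q
      = C (1 / 2) * ((M i p + M i q) * X - (M i p - M i q) * Y) := by
  rw [Matrix.mul_apply, Fintype.sum_eq_add p q hpq fun j hj => by simp [butterfly, hj]]
  simp only [butterfly, hpq, if_true, if_false, true_or, and_self, or_true]
  ring

theorem mul_butterfly_apply_of_ne {j : Fin s} (hjp : j ≠ p) (hjq : j ≠ q) (M : LMat r s)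
    (i : Fin r) : (M * butterfly p q X Y) i j = M i j := by
  rw [Matrix.mul_apply, Fintype.sum_eq_single j fun l hl => by simp [butterfly, hl, hjp, hjq]]
  simp [butterfly, hjp, hjq]

theorem mstar_butterfly (p q : Fin s) (X Y : ℂ[T;T⁻¹]) :
    mstar (butterfly p q X Y) = butterfly p q (pstar X) (pstar Y) := by
  have star_half : star (1 / 2 : ℂ) = 1 / 2 := by simp
  ext1 i j
  simp only [mstar, butterfly, pstar_eq_pstarHom, apply_ite pstarHom, map_mul, map_add, map_sub,
    map_one, map_zero]
  simp only [← pstar_eq_pstarHom, pstar_C, star_half]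
  grind

theorem C_half_add_C_half : (C (1 / 2) + C (1 / 2) : ℂ[T;T⁻¹]) = 1 := by
  rw [← map_add, add_halves, map_one]

theorem butterfly_one_one (p q : Fin s) : butterfly p q 1 1 = 1 := by
  ext1 i j
  rw [butterfly, mul_add, mul_one, C_half_add_C_half, sub_self, mul_zero, ite_self, ite_self,
    one_apply]

theorem butterfly_mul_butterfly (hpq : p ≠ q) (X Y X' Y' : ℂ[T;T⁻¹]) :
    butterfly p q X Y * butterfly p q X' Y' = butterfly p q (X * X') (Y * Y') := by
  have half := C_half_add_C_half
  ext1 i j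
  obtain rfl | hjp := eq_or_ne j p
  · rw [mul_butterfly_apply_left hpq]
    simp only [butterfly]
    grind
  obtain rfl | hjq := eq_or_ne j q
  · rw [mul_butterfly_apply_right hpq]
    simp only [butterfly]
    grind
  · rw [mul_butterfly_apply_of_ne hjp hjq]
    simp only [butterfly, hjp, hjq]
    grind

theorem isParaunitary_butterfly (hpq : p ≠ q) (hX : X * pstar X = 1) (hY : Y * pstar Y = 1) :
    IsParaunitary (butterfly p q X Y) := by
  rw [IsParaunitary, mstar_butterfly, butterfly_mul_butterfly hpq, hX, hY, butterfly_one_one]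

theorem hasCoeffsIn_butterfly (p q : Fin s) (hX : X ∈ laurentSubring K)
    (hY : Y ∈ laurentSubring K) : HasCoeffsIn K (butterfly p q X Y) := fun i j => by
  have half_mem : C (1 / 2) ∈ laurentSubring K :=
    C_mem_laurentSubring (K.div_mem K.one_mem (ofNat_mem K 2))
  change butterfly p q X Y i j ∈ laurentSubring K
  rw [butterfly]
  split_ifs
  exacts [mul_mem half_mem (add_mem hX hY), one_mem _, mul_mem half_mem (sub_mem hX hY),
    zero_mem _]

/-- The pattern vector with the exponents at `p` and `q` switched between `0` and `-1`. -/
def togglePattern (p q : Fin s) (σ : Fin s → SymType) : Fin s → SymType := fun j =>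
  if j = p ∨ j = q then ⟨(σ j).sign, -1 - (σ j).exp⟩ else σ j

theorem IsNormalized.togglePattern {σ : Fin s → SymType} (hσ : IsNormalized σ) (p q : Fin s) :
    IsNormalized (togglePattern p q σ) := fun j => by
  have := hσ j
  rw [SymExt.togglePattern]
  split_ifs <;> grind

theorem coeff_T_reflect (m n k : ℤ) : (T m : ℂ[T;T⁻¹]).coeff (m + n - k) = (T n).coeff k := by
  rw [T_apply, T_apply]
  exact if_congr (by omega) rfl rfl

theorem hasSym_T_add_T (m n : ℤ) : HasSym (T m + T n) ⟨1, m + n⟩ := fun k => by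
  have h := coeff_T_reflect n m k
  rw [add_comm n] at h
  rw [coeff_add_apply, coeff_add_apply, coeff_T_reflect, h]
  simp [add_comm]

theorem hasSym_T_sub_T (m n : ℤ) : HasSym (T m - T n) ⟨-1, m + n⟩ := fun k => by
  have h := coeff_T_reflect n m k
  rw [add_comm n] at h
  rw [coeff_sub_apply, coeff_sub_apply, coeff_T_reflect, h]
  simp

variable {σ : Fin s → SymType} {e : ℤ}

theorem starMul_togglePattern (hp : σ p = ⟨1, e⟩) (hq : σ q = ⟨-1, e⟩) {i j : Fin s}
    (hi : i = p ∨ i = q) (hj : j = p ∨ j = q) :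
    starMul σ (togglePattern p q σ) i j
      = ⟨(σ i).sign * (σ j).sign, -e + (-1 - e)⟩ := by
  have exp_eq {l : Fin s} (hl : l = p ∨ l = q) : (σ l).exp = e := by
    obtain rfl | rfl := hl
    exacts [congrArg SymType.exp hp, congrArg SymType.exp hq]
  simp only [starMul, togglePattern, if_pos hj, exp_eq hi, exp_eq hj]
  rw [neg_add_eq_sub]

theorem hasSymMatrix_butterfly (hp : σ p = ⟨1, e⟩) (hq : σ q = ⟨-1, e⟩) :
    HasSymMatrix (butterfly p q (T (-e)) (T (-1 - e))) (starMul σ (togglePattern p q σ)) := by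
  intro i j
  rw [butterfly]
  split_ifs with hij h h
  · subst hij
    rw [starMul_togglePattern hp hq h h, Int.units_mul_self]
    simpa only [one_mul, zero_add] using (HasSym.C (1 / 2)).mul (hasSym_T_add_T (-e) (-1 - e))
  · subst hij
    simpa only [starMul, togglePattern, if_neg h, sub_self, Int.units_mul_self, map_one] using
      HasSym.C 1
  · have sign_mul : (σ i).sign * (σ j).sign = -1 := by
      obtain ⟨rfl, rfl⟩ | ⟨rfl, rfl⟩ := h <;> rw [hp, hq] <;> rfl
    rw [starMul_togglePattern hp hq (by tauto) (by tauto), sign_mul]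
    simpa only [one_mul, zero_add] using (HasSym.C (1 / 2)).mul (hasSym_T_sub_T (-e) (-1 - e))
  · exact .zero _

theorem centered_butterfly (hp : σ p = ⟨1, e⟩) (hq : σ q = ⟨-1, e⟩) :
    centered σ (togglePattern p q σ) (butterfly p q (T (-e)) (T (-1 - e)))
      = butterfly p q (T 1) (T (-1)) := by
  have shift_fst : (T (2 * e + 1) * T (2 * -e) : ℂ[T;T⁻¹]) = T 1 := by
    rw [← T_add]; congr 1; ring
  have shift_snd : (T (2 * e + 1) * T (2 * (-1 - e)) : ℂ[T;T⁻¹]) = T (-1) := by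
    rw [← T_add]; congr 1; ring
  have exp_sub (i j : Fin s) (hi : i = p ∨ i = q) (hj : j = p ∨ j = q) :
      (σ i).exp - (togglePattern p q σ j).exp = 2 * e + 1 := by
    have := congrArg SymType.exp (starMul_togglePattern hp hq hi hj)
    simp only [starMul] at this
    omega
  ext1 i j
  rw [centered, butterfly, butterfly]
  split_ifs with hij h h
  · rw [exp_sub i j h (hij ▸ h), map_mul, map_add, doubling_C, doubling_T, doubling_T, ← shift_fst,
      ← shift_snd]
    ring
  · rw [togglePattern, ← hij, if_neg h, sub_self, T_zero, map_one, one_mul]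
  · rw [exp_sub i j (by tauto) (by tauto), map_mul, map_sub, doubling_C, doubling_T, doubling_T,
      ← shift_fst, ← shift_snd]
    ring
  · rw [map_zero, mul_zero]

theorem ne_of_sign_eq (hp : σ p = ⟨1, e⟩) (hq : σ q = ⟨-1, e⟩) : p ≠ q := by
  rintro rfl
  simp [hp] at hq

theorem isSymParaunitary_butterfly (hp : σ p = ⟨1, e⟩) (hq : σ q = ⟨-1, e⟩) :
    IsSymParaunitary K σ (togglePattern p q σ) (butterfly p q (T (-e)) (T (-1 - e))) where
  paraunitary := by
    refine isParaunitary_butterfly (ne_of_sign_eq hp hq) ?_ ?_ <;>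
      rw [pstar_T, ← T_add, add_neg_cancel, T_zero]
  coeffs := hasCoeffsIn_butterfly p q (T_mem_laurentSubring _) (T_mem_laurentSubring _)
  symm := hasSymMatrix_butterfly hp hq

theorem rowCoeff_mul_butterfly_eq_zero (hpq : p ≠ q) {M : LMat r s} {i : Fin r} {n : ℤ}
    (hadd : rowCoeff M i (n - 1) p + rowCoeff M i (n - 1) q = 0)
    (hsub : rowCoeff M i (n + 1) p = rowCoeff M i (n + 1) q)
    (hne : ∀ j, j ≠ p → j ≠ q → rowCoeff M i n j = 0) :
    rowCoeff (M * butterfly p q (T 1) (T (-1))) i n = 0 := by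
  simp only [rowCoeff] at hadd hsub hne
  ext j
  rw [rowCoeff]
  obtain rfl | hjp := eq_or_ne j p
  · rw [mul_butterfly_apply_left hpq, coeff_C_mul, coeff_add_apply, coeff_mul_T, coeff_mul_T,
      coeff_add_apply, coeff_sub_apply, sub_neg_eq_add, hadd, hsub, sub_self, add_zero, mul_zero]
    rfl
  obtain rfl | hjq := eq_or_ne j q
  · rw [mul_butterfly_apply_right hpq, coeff_C_mul, coeff_sub_apply, coeff_mul_T, coeff_mul_T,
      coeff_add_apply, coeff_sub_apply, sub_neg_eq_add, hadd, hsub, sub_self, sub_zero, mul_zero]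
    rfl
  · rw [mul_butterfly_apply_of_ne hjp hjq]
    exact hne j hjp hjq

end Butterfly

/-! ### Lowering the degree -/

section Reduction

variable {ρ : Fin r → SymType} {σ σ' : Fin s → SymType}

section Butterfly

variable {p q : Fin s} {e : ℤ} {M : LMat r s} {i : Fin r} {d : ℤ}

theorem RowBound.mul_butterfly_of_eq (hM : RowBound ρ σ M i d) (hp : σ p = ⟨1, e⟩)
    (hq : σ q = ⟨-1, e⟩)
    (heq : rowCoeff (centered ρ σ M) i (-d) p = rowCoeff (centered ρ σ M) i (-d) q) :
    RowBound ρ (togglePattern p q σ) (M * butterfly p q (T (-e)) (T (-1 - e))) i d := by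
  intro n hn
  rw [centered_mul (σ := σ), centered_butterfly hp hq]
  refine rowCoeff_mul_butterfly_eq_zero (ne_of_sign_eq hp hq) ?_ ?_ fun j _ _ => by
    rw [hM n hn]; rfl
  · rw [hM (n - 1) (by omega)]
    exact add_zero _
  · obtain h | h := (show n + 1 ≤ -d by omega).lt_or_eq
    · rw [hM _ h]; rfl
    · rwa [h]

theorem RowBound.mul_butterfly_sub_one (hM : RowBound ρ σ M i d) (hp : σ p = ⟨1, e⟩)
    (hq : σ q = ⟨-1, e⟩) {c : ℂ} (hc : c ≠ 0)
    (hx : rowCoeff (centered ρ σ M) i (-d) = c • (Pi.single p 1 + Pi.single q 1)) :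
    RowBound ρ (togglePattern p q σ) (M * butterfly p q (T (-e)) (T (-1 - e))) i (d - 1) := by
  have hpq := ne_of_sign_eq hp hq
  have hxp : rowCoeff (centered ρ σ M) i (-d) p = c := by simp [hx, hpq]
  have hxq : rowCoeff (centered ρ σ M) i (-d) q = c := by simp [hx, hpq.symm]
  have next_eq_zero {j : Fin s} (hj : rowCoeff (centered ρ σ M) i (-d) j = c) :
      rowCoeff (centered ρ σ M) i (-d + 1) j = 0 := by
    obtain ⟨k, hk⟩ := exists_eq_of_coeff_centered_ne_zero (hj.trans_ne hc)
    exact coeff_centered_of_not_dvd _ (by omega)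
  refine (hM.mul_butterfly_of_eq hp hq (hxp.trans hxq.symm)).sub_one ?_
  rw [centered_mul (σ := σ), centered_butterfly hp hq]
  refine rowCoeff_mul_butterfly_eq_zero hpq ?_ ?_ fun j hjp hjq => by simp [hx, hjp, hjq]
  · rw [hM _ (by omega)]
    exact add_zero _
  · rw [next_eq_zero hxp, next_eq_zero hxq]

end Butterfly

/-- A matrix `A` that shortens every row with bottom coefficient vector `x`, and lengthens no row
whose bottom coefficient vector is orthogonal to `x`. -/
structure IsShorteningStep (K : Subfield ℂ) (σ σ' : Fin s → SymType) (x : Fin s → ℂ)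
    (A : LMat s s) : Prop where
  isNormalized : IsNormalized σ'
  isSymParaunitary : IsSymParaunitary K σ σ' A
  rowBound_of_signedInner_eq_zero {r : ℕ} {ρ : Fin r → SymType} {M : LMat r s} {i : Fin r} {d : ℤ}
    (hM : RowBound ρ σ M i d) (hx : signedInner σ (rowCoeff (centered ρ σ M) i (-d)) x = 0) :
    RowBound ρ σ' (M * A) i d
  rowBound_sub_one {r : ℕ} {ρ : Fin r → SymType} {M : LMat r s} {i : Fin r} {d : ℤ}
    (hM : RowBound ρ σ M i d) (hx : rowCoeff (centered ρ σ M) i (-d) = x) :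
    RowBound ρ σ' (M * A) i (d - 1)

theorem exists_isShorteningStep (hK : IsAdmissibleField K) (hσ : IsNormalized σ)
    {x : Fin s → ℂ} (hx : x ≠ 0) (hxK : ∀ j, x j ∈ K) {e : ℤ}
    (hxe : ∀ j, x j ≠ 0 → (σ j).exp = e) (hiso : signedInner σ x x = 0) :
    ∃ σ' A, IsShorteningStep K σ σ' x A := by
  obtain ⟨V, c, p, q, hV, hc, hp, hq, hxV, horth⟩ :=
    exists_isLabeledIsometry_vecMul_isotropic hK hx hxK hxe hiso
  have rowCoeff_mul {r : ℕ} (ρ : Fin r → SymType) (M : LMat r s) (i : Fin r) (n : ℤ) :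
      rowCoeff (centered ρ σ (M * V.map C)) i n = rowCoeff (centered ρ σ M) i n ᵥ* V := by
    rw [centered_mul (σ := σ), hV.centered_map_C, rowCoeff_mul_map_C]
  refine ⟨togglePattern p q σ, V.map C * butterfly p q (T (-e)) (T (-1 - e)),
    hσ.togglePattern p q, hV.isSymParaunitary_map_C.mul (isSymParaunitary_butterfly hp hq),
    fun {r ρ M i d} hM hMx => ?_, fun {r ρ M i d} hM hMx => ?_⟩
  · rw [← Matrix.mul_assoc]
    refine (hM.mul_map_C hV).mul_butterfly_of_eq hp hq ?_
    rw [rowCoeff_mul]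
    exact horth _ hMx
  · rw [← Matrix.mul_assoc]
    refine (hM.mul_map_C hV).mul_butterfly_sub_one hp hq hc ?_
    rw [rowCoeff_mul, hMx, hxV]

theorem exists_isShorteningStep_rowCoeff (hK : IsAdmissibleField K) (hσ : IsNormalized σ)
    {M : LMat r s} (hM : IsSymParaunitary K ρ σ M) {i : Fin r} {d : ℤ} (hd : 0 < d)
    (hMd : RowBound ρ σ M i d) (h0 : rowCoeff (centered ρ σ M) i (-d) ≠ 0) :
    ∃ σ' A, IsShorteningStep K σ σ' (rowCoeff (centered ρ σ M) i (-d)) A := by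
  obtain ⟨j₀, hj₀⟩ := Function.ne_iff.1 h0
  refine exists_isShorteningStep hK hσ h0 (e := (σ j₀).exp)
    (fun j => hM.coeffs.centered i j _) (fun j hj => ?_)
    (hM.signedInner_rowCoeff_eq_zero hMd hMd (by omega))
  obtain ⟨k, hk⟩ := exists_eq_of_coeff_centered_ne_zero hj
  obtain ⟨k₀, hk₀⟩ := exists_eq_of_coeff_centered_ne_zero hj₀
  have := hσ j
  have := hσ j₀
  omega

/-- A square matrix with pattern `starMul σ σ'`, `σ'` normalized, of degree at most `2` in `w`. If
`σ` is normalized as well, its terms have degree at most `1` in `z`. -/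
structure IsReducer (K : Subfield ℂ) (σ σ' : Fin s → SymType) (B : LMat s s) : Prop where
  isNormalized : IsNormalized σ'
  isSymParaunitary : IsSymParaunitary K σ σ' B
  halfDegreeLE : HalfDegreeLE σ σ' B 2

theorem IsReducer.supportedInUnit (hσ : IsNormalized σ) {B : LMat s s}
    (hB : IsReducer K σ σ' B) : SupportedInUnit B :=
  hB.halfDegreeLE.supportedInUnit hB.isSymParaunitary.symm hσ hB.isNormalized

theorem IsReducer.one (hσ : IsNormalized σ) : IsReducer K σ σ 1 :=
  ⟨hσ, .one, fun i => (rowBound_one i).mono zero_le_two⟩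

theorem signedInner_rowCoeff_mul_eq_zero {Q : LMat r s} (hQ : IsSymParaunitary K ρ σ Q) {m : ℤ}
    (hQm : HalfDegreeLE ρ σ Q m) {B : LMat s s} (hB : IsSymParaunitary K σ σ' B) {l : Fin s}
    {i : Fin r} {d d' : ℤ} (hBd : RowBound σ σ' B l d) (hQBd : RowBound ρ σ' (Q * B) i d')
    (hdm : m < d + d') :
    signedInner σ' (rowCoeff (centered σ σ' B) l (-d)) (rowCoeff (centered ρ σ' (Q * B)) i (-d'))
      = 0 := by
  refine signedInner_rowCoeff_eq_zero (hQ.mul hB).symm hBd hQBd ?_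
  have mul_mstar_eq : B * mstar (Q * B) = mstar Q := by
    rw [mstar_mul, ← Matrix.mul_assoc, hB.paraunitary.mul_mstar_self, Matrix.one_mul]
  rw [mul_mstar_eq, centered_mstar, mstar, coeff_pstar, neg_neg, star_eq_zero,
    ← neg_neg (d + d'), hQ.symm.coeff_centered_neg,
    show (centered ρ σ Q i l).coeff _ = 0 from congrFun (hQm i _ (neg_lt_neg hdm)) l,
    mul_zero, mul_zero]

theorem IsReducer.exists_lower_row (hK : IsAdmissibleField K) {Q : LMat r s}
    (hQ : IsSymParaunitary K ρ σ Q) {m : ℤ} (hm : 2 ≤ m) (hQm : HalfDegreeLE ρ σ Q m)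
    {B : LMat s s} (hB : IsReducer K σ σ' B) {d : Fin r → ℤ} (hd0 : ∀ l, 0 ≤ d l)
    (hd : ∀ l, RowBound ρ σ' (Q * B) l (d l)) {i : Fin r} (hi : m - 2 < d i) :
    ∃ σ'' B', IsReducer K σ σ'' B' ∧ RowBound ρ σ'' (Q * B') i (d i - 1) ∧
      ∀ l, RowBound ρ σ'' (Q * B') l (d l) := by
  have hQB := hQ.mul hB.isSymParaunitary
  by_cases h0 : rowCoeff (centered ρ σ' (Q * B)) i (-d i) = 0
  · exact ⟨σ', B, hB, (hd i).sub_one h0, hd⟩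
  have hdi : 0 < d i := by omega
  obtain ⟨σ'', A, hA⟩ := exists_isShorteningStep_rowCoeff hK hB.isNormalized hQB hdi (hd i) h0
  refine ⟨σ'', B * A, ⟨hA.isNormalized, hB.isSymParaunitary.mul hA.isSymParaunitary,
    fun l => hA.rowBound_of_signedInner_eq_zero (hB.halfDegreeLE l) ?_⟩, ?_⟩
  · exact signedInner_rowCoeff_mul_eq_zero hQ hQm hB.isSymParaunitary (hB.halfDegreeLE l) (hd i)
      (by omega)
  · rw [← Matrix.mul_assoc]
    refine ⟨hA.rowBound_sub_one (hd i) rfl, fun l => ?_⟩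
    exact hA.rowBound_of_signedInner_eq_zero (hd l)
      (hQB.signedInner_rowCoeff_eq_zero (hd l) (hd i) (add_pos_of_nonneg_of_pos (hd0 l) hdi))

theorem exists_isReducer (hK : IsAdmissibleField K) (hσ : IsNormalized σ) {Q : LMat r s}
    (hQ : IsSymParaunitary K ρ σ Q) {m : ℤ} (hm : 2 ≤ m) (hQm : HalfDegreeLE ρ σ Q m) :
    ∃ σ' B, IsReducer K σ σ' B ∧ HalfDegreeLE ρ σ' (Q * B) (m - 2) := by
  suffices lower : ∀ (d : Fin r → ℕ) (σ' : Fin s → SymType) (B : LMat s s), IsReducer K σ σ' B →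
      (∀ i, RowBound ρ σ' (Q * B) i (d i)) →
      ∃ σ' B, IsReducer K σ σ' B ∧ HalfDegreeLE ρ σ' (Q * B) (m - 2) by
    refine lower (fun _ => m.toNat) σ 1 (.one hσ) fun i => ?_
    rw [Matrix.mul_one, Int.toNat_of_nonneg (by omega)]
    exact hQm i
  intro d
  induction d using WellFoundedLT.induction with | _ d ih
  intro σ' B hB hd
  by_cases! hall : ∀ i, (d i : ℤ) ≤ m - 2
  · exact ⟨σ', B, hB, fun i => (hd i).mono (hall i)⟩
  obtain ⟨i, hi⟩ := hall
  obtain ⟨σ'', B', hB', hd'i, hd'⟩ :=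
    hB.exists_lower_row hK hQ hm hQm (fun l => Int.natCast_nonneg (d l)) hd hi
  have update_lt : Function.update d i (d i - 1) < d := update_lt_self_iff.2 (by omega)
  refine ih _ update_lt σ'' B' hB' ?_
  refine (Function.forall_update_iff d fun l n => RowBound ρ σ'' (Q * B') l (n : ℕ)).2
    ⟨?_, fun l _ => hd' l⟩
  rwa [Nat.cast_pred (by omega)]

end Reduction

/-! ### Chains of elementary factors -/

theorem SupportedInUnit.mstar {M : LMat s s} (hM : SupportedInUnit M) :
    SupportedInUnit (mstar M) := fun i j k hk => by
  rw [SymExt.mstar, coeff_pstar, star_ne_zero] at hk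
  have := hM j i (-k) hk
  omega

theorem SupportedInUnit.map_C_mul {M : LMat s s} (hM : SupportedInUnit M)
    (V : Matrix (Fin s) (Fin s) ℂ) : SupportedInUnit (V.map C * M) := fun i j k hk => by
  rw [Matrix.mul_apply, coeff_sum_apply] at hk
  obtain ⟨l, -, hl⟩ := Finset.exists_ne_zero_of_sum_ne_zero hk
  rw [map_apply, coeff_C_mul] at hl
  exact hM l j k (right_ne_zero_of_mul hl)

section Factor

variable {ρ : Fin r → SymType} {σ : Fin s → SymType} {Q : LMat r s}

theorem exists_eq_mul_supportedInUnit (hK : IsAdmissibleField K) (hσ : IsNormalized σ)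
    (hQ : IsSymParaunitary K ρ σ Q) {m : ℤ} (hm : 2 ≤ m) (hQm : HalfDegreeLE ρ σ Q m) :
    ∃ (σ' : Fin s → SymType) (Q' : LMat r s) (E : LMat s s), IsNormalized σ' ∧
      IsSymParaunitary K ρ σ' Q' ∧ HalfDegreeLE ρ σ' Q' (m - 2) ∧
      IsSymParaunitary K σ' σ E ∧ SupportedInUnit E ∧ Q = Q' * E := by
  obtain ⟨σ', B, hB, hQB⟩ := exists_isReducer hK hσ hQ hm hQm
  refine ⟨σ', Q * B, mstar B, hB.isNormalized, hQ.mul hB.isSymParaunitary, hQB,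
    hB.isSymParaunitary.mstar hK, (hB.supportedInUnit hσ).mstar, ?_⟩
  rw [Matrix.mul_assoc, hB.isSymParaunitary.paraunitary.mul_mstar_self, Matrix.mul_one]

theorem HasSymMatrix.pattern_eq_of_coeff_ne_zero (hQ : HasSymMatrix Q (starMul ρ σ)) {i : Fin r}
    {j : Fin s} (h0 : (Q i j).coeff 0 ≠ 0) (hexp : (ρ i).exp = (σ j).exp) : ρ i = σ j := by
  have hsymm := hQ i j 0
  simp only [starMul, hexp, sub_self] at hsymm
  have sign_mul : (((ρ i).sign * (σ j).sign : ℤˣ) : ℤ) = 1 := by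
    exact_mod_cast mul_right_cancel₀ h0 (hsymm.symm.trans (one_mul _).symm)
  have sign_eq : (ρ i).sign = (σ j).sign := by
    rw [← Int.units_inv_eq_self (σ j).sign]
    exact eq_inv_of_mul_eq_one_left (Units.ext sign_mul)
  exact (SymType.mk.injEq ..).mpr ⟨sign_eq, hexp⟩

theorem IsSymParaunitary.exists_eq_map_C (hQ : IsSymParaunitary K ρ σ Q) (hρ : IsNormalized ρ)
    (hσ : IsNormalized σ) (hQ0 : HalfDegreeLE ρ σ Q 0) :
    ∃ V, IsLabeledIsometry K ρ σ V ∧ Q = V.map C := by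
  have of_coeff_ne_zero {i : Fin r} {j : Fin s} {k : ℤ} (hk : (Q i j).coeff k ≠ 0) :
      k = 0 ∧ (ρ i).exp = (σ j).exp := by
    have := hQ0.bounds hQ.symm hk
    have := hρ i
    have := hσ j
    omega
  let V : Matrix (Fin r) (Fin s) ℂ := Matrix.of fun i j => (Q i j).coeff 0
  have hQV : Q = V.map C := by
    ext i j k
    rw [map_apply, C_apply]
    split_ifs with hk
    · exact congrArg _ hk
    · exact not_imp_comm.1 of_coeff_ne_zero fun h => hk h.1
  refine ⟨V, ⟨?_, fun i j => hQ.coeffs i j 0, fun i j hij => ?_⟩, hQV⟩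
  · have h := hQ.paraunitary.mul_mstar_self
    rw [hQV, mstar_map_C, ← Matrix.map_mul, ← Matrix.map_one C (map_zero _) (map_one _)] at h
    exact Matrix.map_injective (fun a b hab => by simpa using congrArg (·.coeff 0) hab) h
  · exact hQ.symm.pattern_eq_of_coeff_ne_zero hij (of_coeff_ne_zero hij).2

theorem firstRows_mul_apply (hrs : r ≤ s) (M : LMat s t) (i : Fin r) :
    (firstRows r s * M) i = M (Fin.castLE hrs i) := by
  have firstRows_apply : firstRows r s i = Pi.single (Fin.castLE hrs i) 1 := by
    ext1 j
    rw [firstRows, Pi.single_apply]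
    exact if_congr (by rw [Fin.ext_iff, eq_comm]; rfl) rfl rfl
  rw [mul_apply_eq_vecMul, firstRows_apply, single_one_vecMul]
  rfl

theorem IsSymParaunitary.exists_eq_firstRows_mul_map_C (hK : IsAdmissibleField K) (hrs : r ≤ s)
    (hQ : IsSymParaunitary K ρ σ Q) (hρ : IsNormalized ρ) (hσ : IsNormalized σ)
    (hQ0 : HalfDegreeLE ρ σ Q 0) :
    ∃ (τ : Fin s → SymType) (W : Matrix (Fin s) (Fin s) ℂ), IsLabeledIsometry K τ σ W ∧
      (∀ i, τ (Fin.castLE hrs i) = ρ i) ∧ Q = firstRows r s * W.map C := by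
  obtain ⟨V, hV, rfl⟩ := hQ.exists_eq_map_C hρ hσ hQ0
  obtain ⟨W, τ, hW, hWV, hτ⟩ := hV.exists_extension hK (Fin.castLEEmb hrs)
  refine ⟨τ, W, hW, hτ, ?_⟩
  refine funext fun i => ?_
  rw [firstRows_mul_apply hrs]
  exact congrArg (C ∘ ·) (hWV i).symm

end Factor

/-- The product `F_{n-1} ⋯ F_0`, which is `descProd F` for `n = J + 2`. -/
def revProd {n : ℕ} (F : Fin n → LMat s s) : LMat s s := (List.ofFn fun j => F j.rev).prod

theorem revProd_zero (F : Fin 0 → LMat s s) : revProd F = 1 := rfl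

theorem revProd_cons {n : ℕ} (B : LMat s s) (F : Fin n → LMat s s) :
    revProd (Fin.cons B F : Fin (n + 1) → LMat s s) = revProd F * B := by
  rw [revProd, List.ofFn_succ', List.concat_eq_append, List.prod_append, List.prod_singleton,
    Fin.rev_last, Fin.cons_zero]
  simp only [Fin.rev_castSucc, Fin.cons_succ]
  rfl

theorem revProd_snoc {n : ℕ} (B : LMat s s) (F : Fin n → LMat s s) :
    revProd (Fin.snoc F B : Fin (n + 1) → LMat s s) = B * revProd F := by
  rw [revProd, List.ofFn_succ, List.prod_cons, Fin.rev_zero, Fin.snoc_last]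
  simp only [Fin.rev_succ, Fin.snoc_castSucc]
  rfl

theorem IsParaunitary.revProd {n : ℕ} {F : Fin n → LMat s s} (hF : ∀ j, IsParaunitary (F j)) :
    IsParaunitary (revProd F) := by
  induction n with
  | zero => exact .one
  | succ n ih =>
    rw [← Fin.cons_self_tail F, revProd_cons]
    exact (ih fun j => hF j.succ).mul (hF 0)

/-- The pattern of every factor `F_j` is the one between consecutive vectors `τ_{j+1}` and `τ_j`
of a sequence. -/
def IsChain (K : Subfield ℂ) {n : ℕ} (F : Fin n → LMat s s) (τ : Fin (n + 1) → Fin s → SymType) :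
    Prop :=
  ∀ j, IsSymParaunitary K (τ j.succ) (τ j.castSucc) (F j)

namespace IsChain

variable {n : ℕ} {F : Fin n → LMat s s} {τ : Fin (n + 1) → Fin s → SymType} {σ : Fin s → SymType}
  {B : LMat s s}

theorem cons (hF : IsChain K F τ) (hB : IsSymParaunitary K (τ 0) σ B) :
    IsChain K (Fin.cons B F : Fin (n + 1) → LMat s s)
      (Fin.cons σ τ : Fin (n + 2) → Fin s → SymType) :=
  Fin.cases hB hF

theorem snoc (hF : IsChain K F τ) (hB : IsSymParaunitary K σ (τ (Fin.last n)) B) :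
    IsChain K (Fin.snoc F B : Fin (n + 1) → LMat s s)
      (Fin.snoc τ σ : Fin (n + 2) → Fin s → SymType) := by
  refine Fin.lastCases ?_ fun j => ?_
  · rwa [Fin.snoc_last, Fin.succ_last, Fin.snoc_last, Fin.snoc_castSucc]
  · rw [Fin.snoc_castSucc, Fin.snoc_castSucc, Fin.succ_castSucc, Fin.snoc_castSucc]
    exact hF j

end IsChain

theorem exists_isChain_supportedInUnit (hK : IsAdmissibleField K) (hrs : r ≤ s)
    {ρ : Fin r → SymType} (hρ : IsNormalized ρ) (n : ℕ) {σ : Fin s → SymType}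
    (hσ : IsNormalized σ) {Q : LMat r s} (hQ : IsSymParaunitary K ρ σ Q)
    (hQn : HalfDegreeLE ρ σ Q (2 * (n + 1))) :
    ∃ (F : Fin (n + 1) → LMat s s) (τ : Fin (n + 2) → Fin s → SymType), IsChain K F τ ∧
      (∀ j, SupportedInUnit (F j)) ∧ τ 0 = σ ∧
      (∀ i, τ (Fin.last (n + 1)) (Fin.castLE hrs i) = ρ i) ∧ Q = firstRows r s * revProd F := by
  induction n generalizing σ Q with
  | zero =>
    obtain ⟨σ', Q', E, hσ', hQ', hQ'n, hE, hE1, rfl⟩ :=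
      exists_eq_mul_supportedInUnit hK hσ hQ (by omega) hQn
    obtain ⟨τ, W, hW, hτ, rfl⟩ := hQ'.exists_eq_firstRows_mul_map_C hK hrs hρ hσ' hQ'n
    have nil : IsChain K (Fin.elim0 : Fin 0 → LMat s s) fun _ => τ := fun j => j.elim0
    refine ⟨_, _, nil.cons (hW.isSymParaunitary_map_C.mul hE),
      Fin.cases (hE1.map_C_mul W) fun j => j.elim0, rfl, hτ, ?_⟩
    rw [revProd_cons, revProd_zero, Matrix.one_mul, Matrix.mul_assoc]
  | succ n ih =>
    obtain ⟨σ', Q', E, hσ', hQ', hQ'n, hE, hE1, rfl⟩ :=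
      exists_eq_mul_supportedInUnit hK hσ hQ (by omega) hQn
    obtain ⟨F, τ, hF, hF1, rfl, hτ, rfl⟩ := ih hσ' hQ' (by convert hQ'n using 1; push_cast; ring)
    refine ⟨_, _, hF.cons hE, Fin.cases hE1 hF1, rfl, hτ, ?_⟩
    rw [revProd_cons, Matrix.mul_assoc]

/-! ### Reorganizing matrices -/

section HalfDegree

variable {ρ : Fin r → SymType} {σ : Fin s → SymType} {τ : Fin t → SymType} {d d' : ℤ}

theorem HalfDegreeLE.mul {M : LMat r s} {N : LMat s t} (hM : HalfDegreeLE ρ σ M d)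
    (hN : HalfDegreeLE σ τ N d') : HalfDegreeLE ρ τ (M * N) (d + d') := fun i n hn => by
  ext j
  rw [rowCoeff, centered_mul (σ := σ), Matrix.mul_apply, coeff_sum_apply]
  refine Finset.sum_eq_zero fun l _ => ?_
  rw [coeff_mul_eq_sum]
  refine Finset.sum_eq_zero fun k _ => ?_
  obtain hk | hk : k < -d ∨ n - k < -d' := by omega
  · rw [show (centered ρ σ M i l).coeff k = 0 from congrFun (hM i k hk) l, zero_mul]
  · rw [show (centered σ τ N l j).coeff (n - k) = 0 from congrFun (hN l _ hk) j, mul_zero]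

theorem HalfDegreeLE.mstar {M : LMat r s} (hd : HalfDegreeLE ρ σ M d)
    (hM : HasSymMatrix M (starMul ρ σ)) : HalfDegreeLE σ ρ (mstar M) d := fun j n hn => by
  ext i
  rw [rowCoeff, centered_mstar, SymExt.mstar, coeff_pstar, hM.coeff_centered_neg,
    show (centered ρ σ M i j).coeff n = 0 from congrFun (hd i n hn) j, mul_zero, mul_zero,
    star_zero]
  rfl

theorem IsLabeledIsometry.halfDegreeLE_map_C {V : Matrix (Fin s) (Fin t) ℂ}
    (hV : IsLabeledIsometry K σ τ V) : HalfDegreeLE σ τ (V.map C) 0 := fun i => by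
  simpa only [Matrix.one_mul] using (rowBound_one i).mul_map_C hV

end HalfDegree

theorem isNormalized_normalize (σ : Fin s → SymType) : IsNormalized fun j => (σ j).normalize :=
  fun j => by
    have le_two_mul_ceil : (σ j).exp ≤ 2 * ⌈((σ j).exp : ℚ) / 2⌉ := by
      have := Int.le_ceil (((σ j).exp : ℚ) / 2)
      rify at this ⊢
      linarith
    have two_mul_ceil_lt : 2 * ⌈((σ j).exp : ℚ) / 2⌉ < (σ j).exp + 2 := by
      have := Int.ceil_lt_add_one (((σ j).exp : ℚ) / 2)
      rify at this ⊢
      linarith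
    simp only [SymType.normalize]
    omega

theorem hasSym_T (n : ℤ) : HasSym (T n) ⟨1, 2 * n⟩ := fun k => by
  rw [two_mul, coeff_T_reflect]
  simp

section Diagonal

variable {ρ σ : Fin s → SymType} {c : Fin s → ℤ}

theorem mstar_diagonal (v : Fin s → ℂ[T;T⁻¹]) :
    mstar (diagonal v) = diagonal fun i => pstar (v i) := by
  rw [mstar_eq_transpose_map, diagonal_map (map_zero _), diagonal_transpose]
  rfl

theorem isSymParaunitary_diagonal_T (hsign : ∀ i, (ρ i).sign = (σ i).sign)
    (hexp : ∀ i, (ρ i).exp = (σ i).exp - 2 * c i) :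
    IsSymParaunitary K ρ σ (diagonal fun i => T (c i)) where
  paraunitary := by
    simp only [IsParaunitary, mstar_diagonal, diagonal_mul_diagonal, pstar_T, ← T_add,
      add_neg_cancel, T_zero, diagonal_one]
  coeffs i j := by
    change _ ∈ laurentSubring K
    rw [diagonal_apply]
    split_ifs
    exacts [T_mem_laurentSubring _, zero_mem _]
  symm i j := by
    rw [diagonal_apply]
    split_ifs with hij
    · subst hij
      simpa only [starMul, hsign, hexp, Int.units_mul_self, sub_sub_cancel] using hasSym_T (c i)
    · exact .zero _

theorem halfDegreeLE_diagonal_T (hexp : ∀ i, (ρ i).exp = (σ i).exp - 2 * c i) :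
    HalfDegreeLE ρ σ (diagonal fun i => T (c i)) 0 := by
  have centered_eq : centered ρ σ (diagonal fun i => T (c i)) = centered σ σ 1 := by
    rw [centered_one]
    ext1 i j
    rw [centered, diagonal_apply, one_apply]
    split_ifs with hij
    · rw [← hij, hexp, doubling_T, ← T_add, show (σ i).exp - 2 * c i - (σ i).exp + 2 * c i = 0 by
        ring, T_zero]
    · rw [map_zero, mul_zero]
  intro i
  rw [RowBound, centered_eq]
  exact rowBound_one i

end Diagonal

theorem isLabeledIsometry_permMatrix {α : Type*} (b : Fin s → α) (e : Equiv.Perm (Fin s)) :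
    IsLabeledIsometry K b (b ∘ e.symm) (e.permMatrix ℂ) := by
  have h := (IsLabeledIsometry.one (K := K) (b := b ∘ e.symm)).submatrix_left e.injective
  rwa [Function.comp_assoc, e.symm_comp_self, Function.comp_id, ← PEquiv.toMatrix_toPEquiv_eq] at h

theorem exists_isReorganizer (σ : Fin s → SymType) : ∃ U, IsReorganizer σ U := by
  refine ⟨_, (Tuple.sort fun k => (σ k).normalize.rank).symm, rfl, ?_⟩
  rw [Equiv.symm_symm]
  exact Tuple.monotone_sort fun k => (σ k).normalize.rank

theorem IsReorganizer.exists_isSymParaunitary {σ : Fin s → SymType} {U : LMat s s}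
    (hU : IsReorganizer σ U) :
    ∃ ρ, IsNormalized ρ ∧ IsSymParaunitary K σ ρ U ∧ HalfDegreeLE σ ρ U 0 := by
  obtain ⟨e, rfl, -⟩ := hU
  let ρ (i : Fin s) : SymType := (σ i).normalize
  have hV := isLabeledIsometry_permMatrix (K := K) ρ e
  have map_permMatrix : e.permMatrix ℂ[T;T⁻¹] = (e.permMatrix ℂ).map C := by
    rw [Equiv.Perm.permMatrix, Equiv.Perm.permMatrix, PEquiv.map_toMatrix]
  have exp_eq (i : Fin s) : (σ i).exp = (ρ i).exp - 2 * -⌈((σ i).exp : ℚ) / 2⌉ := by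
    simp only [ρ, SymType.normalize]
    ring
  have hD := isSymParaunitary_diagonal_T (K := K) (ρ := σ) (σ := ρ) (fun _ => rfl) exp_eq
  rw [map_permMatrix]
  exact ⟨_, fun k => isNormalized_normalize σ (e.symm k),
    hD.mul hV.isSymParaunitary_map_C,
    (halfDegreeLE_diagonal_T exp_eq).mul hV.halfDegreeLE_map_C⟩

/-! ### The outer factors -/

theorem isParaunitary_firstRows (hrs : r ≤ s) : IsParaunitary (firstRows r s) := by
  ext1 i j
  rw [firstRows_mul_apply hrs, mstar, firstRows, one_apply, pstar_eq_pstarHom,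
    apply_ite pstarHom, map_one, map_zero]
  exact if_congr (by rw [Fin.ext_iff, eq_comm]; rfl) rfl rfl

section ExtendById

variable {U : LMat r r}

theorem extendById_eq_submatrix_fromBlocks (t : ℕ) (U : LMat r r) :
    extendById (r + t) U
      = (fromBlocks U 0 0 (1 : LMat t t)).submatrix finSumFinEquiv.symm finSumFinEquiv.symm := by
  ext1 i j
  obtain ⟨i | i, rfl⟩ := finSumFinEquiv.surjective i <;>
    obtain ⟨j | j, rfl⟩ := finSumFinEquiv.surjective j <;>
    simp [extendById, one_apply, Fin.ext_iff] <;> omega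

theorem IsParaunitary.extendById (hrs : r ≤ s) (hU : IsParaunitary U) :
    IsParaunitary (extendById s U) := by
  obtain ⟨t, rfl⟩ := Nat.exists_eq_add_of_le hrs
  have hU' : U * (U.map pstarHom)ᵀ = 1 := hU
  rw [IsParaunitary, extendById_eq_submatrix_fromBlocks, mstar_eq_transpose_map, ← submatrix_map,
    transpose_submatrix, submatrix_mul_equiv, fromBlocks_map, fromBlocks_transpose,
    fromBlocks_multiply]
  simp [hU', Matrix.map_one]

theorem HasCoeffsIn.extendById (s : ℕ) (hU : HasCoeffsIn K U) :
    HasCoeffsIn K (extendById s U) := fun i j => by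
  change _ ∈ laurentSubring K
  rw [SymExt.extendById]
  split_ifs
  exacts [hU _ _, one_mem _, zero_mem _]

theorem HasSymMatrix.extendById {σ ρ : Fin r → SymType} (hrs : r ≤ s)
    (hU : HasSymMatrix U (starMul σ ρ)) {τ : Fin s → SymType}
    (hτ : ∀ i, τ (Fin.castLE hrs i) = ρ i) :
    HasSymMatrix (extendById s U)
      (starMul (fun i => if hi : (i : ℕ) < r then σ ⟨i, hi⟩ else τ i) τ) := fun i j => by
  rw [SymExt.extendById]
  split_ifs with hij h
  · have hτj : τ j = ρ ⟨j, hij.2⟩ := hτ ⟨j, hij.2⟩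
    simpa only [starMul, dif_pos hij.1, hτj] using hU ⟨i, hij.1⟩ ⟨j, hij.2⟩
  · subst h
    have hi : ¬ (i : ℕ) < r := fun hi => hij ⟨hi, hi⟩
    simpa only [starMul, dif_neg hi, Int.units_mul_self, sub_self, map_one] using HasSym.C 1
  · exact .zero _

theorem IsSymParaunitary.extendById {σ ρ : Fin r → SymType} (hrs : r ≤ s)
    (hU : IsSymParaunitary K σ ρ U) {τ : Fin s → SymType}
    (hτ : ∀ i, τ (Fin.castLE hrs i) = ρ i) :
    IsSymParaunitary K (fun i => if hi : (i : ℕ) < r then σ ⟨i, hi⟩ else τ i) τ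
      (extendById s U) where
  paraunitary := hU.paraunitary.extendById hrs
  coeffs := hU.coeffs.extendById s
  symm := hU.symm.extendById hrs hτ

theorem firstRows_mul_extendById (hrs : r ≤ s) (U : LMat r r) :
    firstRows r s * extendById s U = U * firstRows r s := by
  ext1 i j
  rw [firstRows_mul_apply hrs, Matrix.mul_apply, extendById]
  simp only [firstRows, mul_ite, mul_one, mul_zero]
  by_cases hj : (j : ℕ) < r
  · rw [dif_pos ⟨i.2, hj⟩, Finset.sum_eq_single ⟨j, hj⟩
      (fun l _ hl => if_neg fun h => hl (Fin.ext h)) (by simp), if_pos rfl]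
    rfl
  · rw [dif_neg fun h => hj h.2, if_neg fun h : Fin.castLE hrs i = j => hj (h ▸ i.2),
      Finset.sum_eq_zero fun (l : Fin r) _ => if_neg fun h : (l : ℕ) = j => hj (h ▸ l.2)]

end ExtendById

/-! ### The number of factors -/

section Length

theorem sub_le_of_csLength_le {p : ℂ[T;T⁻¹]} {l : ℕ} (hp : csLength p ≤ l) {k k' : ℤ}
    (hk : p.coeff k ≠ 0) (hk' : p.coeff k' ≠ 0) : k' - k ≤ l := by
  rw [← Finsupp.mem_support_iff] at hk hk'
  have hsupp : p.coeff.support.Nonempty := ⟨k, hk⟩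
  rw [csLength, dif_pos hsupp] at hp
  exact (sub_le_sub (Finset.le_max' _ _ hk') (Finset.min'_le _ _ hk)).trans
    (Int.toNat_le.1 (WithBot.coe_le_coe.1 hp))

theorem csLength_le_of_maxHalfLength_le {P : LMat r s} {J : ℕ} (hJ : maxHalfLength P ≤ J)
    (i : Fin r) (j : Fin s) : csLength (P i j) ≤ (2 * J : ℕ) := by
  have hij : (csLength (P i j)).map (fun l : ℕ => ⌈(l : ℚ) / 2⌉₊) ≤ J :=
    (Finset.sup_le_iff.1 hJ) (i, j) (Finset.mem_univ _)
  generalize csLength (P i j) = c at hij ⊢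
  induction c using WithBot.recBotCoe with
  | bot => exact bot_le
  | coe l =>
    have hl := Nat.ceil_le.1 (WithBot.coe_le_coe.1 hij)
    rw [div_le_iff₀ two_pos, mul_comm] at hl
    exact WithBot.coe_le_coe.2 (by exact_mod_cast hl)

theorem HasSym.coeff_exp_sub_ne_zero {p : ℂ[T;T⁻¹]} {σ : SymType} (hp : HasSym p σ) {k : ℤ}
    (hk : p.coeff k ≠ 0) : p.coeff (σ.exp - k) ≠ 0 := by
  rw [hp k]
  exact mul_ne_zero (left_ne_zero_of_mul_eq_one (sign_mul_self _)) hk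

theorem halfDegreeLE_of_maxHalfLength_le {P : LMat r s} {σ₁ : Fin r → SymType}
    {σ₂ : Fin s → SymType} (hP : HasSymMatrix P (starMul σ₁ σ₂)) {J : ℕ}
    (hJ : maxHalfLength P ≤ J) : HalfDegreeLE σ₁ σ₂ P (2 * J) := fun i n hn => by
  ext j
  by_contra hne
  obtain ⟨k, rfl⟩ := exists_eq_of_coeff_centered_ne_zero hne
  rw [rowCoeff, coeff_centered] at hne
  have := sub_le_of_csLength_le (csLength_le_of_maxHalfLength_le hJ i j) hne
    ((hP i j).coeff_exp_sub_ne_zero hne)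
  simp only [starMul] at this
  push_cast at this
  omega

theorem exists_succ_eq_max_one (a : WithBot ℕ) :
    ∃ n : ℕ, ((n + 1 : ℕ) : WithBot ℕ) = max 1 a := by
  induction a using WithBot.recBotCoe with
  | bot => exact ⟨0, (max_eq_left bot_le).symm⟩
  | coe m =>
    refine ⟨max 1 m - 1, ?_⟩
    rw [Nat.sub_add_cancel (le_max_left 1 m)]
    exact WithBot.coe_max 1 m

end Length

section Cascade

variable {σ₁ ρ₁ : Fin r → SymType} {σ₂ : Fin s → SymType} {P : LMat r s} {U₁ : LMat r r}
  {U₂ : LMat s s}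

theorem eq_firstRows_mul_of_mstar_mul_mul_eq (hrs : r ≤ s) (hU₁ : IsParaunitary U₁)
    (hU₂ : IsParaunitary U₂) {M : LMat s s} (hM : mstar U₁ * P * U₂ = firstRows r s * M) :
    P = firstRows r s * (extendById s U₁ * (M * mstar U₂)) :=
  calc P = U₁ * (mstar U₁ * P * U₂) * mstar U₂ := by
        rw [Matrix.mul_assoc U₁, Matrix.mul_assoc _ U₂, hU₂.mul_mstar_self, Matrix.mul_one,
          ← Matrix.mul_assoc, hU₁.mul_mstar_self, Matrix.one_mul]
    _ = firstRows r s * (extendById s U₁ * (M * mstar U₂)) := by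
        rw [hM, ← Matrix.mul_assoc U₁, ← firstRows_mul_extendById hrs]
        simp only [Matrix.mul_assoc]

theorem IsChain.isCascade (hK : IsAdmissibleField K) (hrs : r ≤ s) {n : ℕ}
    {F : Fin (n + 1) → LMat s s} {τ : Fin (n + 2) → Fin s → SymType} (hF : IsChain K F τ)
    (hF1 : ∀ j, SupportedInUnit (F j)) (hU₁ : IsSymParaunitary K σ₁ ρ₁ U₁)
    (hτ : ∀ i, τ (Fin.last (n + 1)) (Fin.castLE hrs i) = ρ₁ i)
    (hU₂ : IsSymParaunitary K σ₂ (τ 0) U₂) (hP : mstar U₁ * P * U₂ = firstRows r s * revProd F)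
    (hn : ((n + 1 : ℕ) : WithBot ℕ) ≤ max 1 (maxHalfLength P)) :
    IsCascade K P U₁ U₂ (n + 1)
      (Fin.snoc (Fin.cons (mstar U₂) F : Fin (n + 2) → LMat s s) (extendById s U₁)) := by
  have hchain := (hF.cons (hU₂.mstar hK)).snoc (hU₁.extendById hrs hτ)
  refine ⟨fun j => (hchain j).coeffs, .revProd fun j => (hchain j).paraunitary, ?_,
    fun j h1 hn => ⟨(hchain j).paraunitary, ?_⟩,
    ⟨_, fun j => (hchain j).symm, fun j => ⟨_, _, _, rfl, rfl⟩⟩, rfl, Fin.snoc_last _ _, hn⟩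
  · have h := eq_firstRows_mul_of_mstar_mul_mul_eq hrs hU₁.paraunitary hU₂.paraunitary hP
    rwa [← revProd_cons, ← revProd_snoc] at h
  · induction j using Fin.lastCases with
    | last => simp at hn
    | cast j =>
      induction j using Fin.cases with
      | zero => simp at h1
      | succ j =>
        rw [Fin.snoc_castSucc]
        exact hF1 j

theorem exists_isCascade (hK : IsAdmissibleField K) (hrs : r ≤ s)
    (hP : IsSymParaunitary K σ₁ σ₂ P) (hU₁ : IsReorganizer σ₁ U₁) (hU₂ : IsReorganizer σ₂ U₂) :
    ∃ (J : ℕ) (F : Fin (J + 2) → LMat s s), IsCascade K P U₁ U₂ J F := by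
  obtain ⟨ρ₁, hρ₁, hU₁, hU₁d⟩ := hU₁.exists_isSymParaunitary (K := K)
  obtain ⟨ρ₂, hρ₂, hU₂, hU₂d⟩ := hU₂.exists_isSymParaunitary (K := K)
  obtain ⟨n, hn⟩ := exists_succ_eq_max_one (maxHalfLength P)
  have hPd := halfDegreeLE_of_maxHalfLength_le hP.symm (hn ▸ le_max_right 1 (maxHalfLength P))
  have hQd : HalfDegreeLE ρ₁ ρ₂ (mstar U₁ * P * U₂) (2 * (n + 1)) := by
    simpa using ((hU₁d.mstar hU₁.symm).mul hPd).mul hU₂d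
  obtain ⟨F, τ, hF, hF1, rfl, hτ, hprod⟩ :=
    exists_isChain_supportedInUnit hK hrs hρ₁ n hρ₂ (((hU₁.mstar hK).mul hP).mul hU₂) hQd
  exact ⟨n + 1, _, hF.isCascade hK hrs hF1 hU₁ hτ hU₂ hprod hn.le⟩

end Cascade

/-! ### Symmetry of a cascade -/

section Converse

-- The two factorizations differ by a common factor `ε z^c`, which is moved from `σ` to `β'`.
theorem exists_starMul_eq_starMul {α σ : Fin r → SymType} {ω τ : Fin s → SymType}
    (h : starMul α ω = starMul σ τ) (j : Fin s) (β : Fin t → SymType) :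
    ∃ β' : Fin t → SymType, starMul α β = starMul σ β' := by
  refine ⟨fun k => ⟨(ω j).sign * (τ j).sign * (β k).sign,
    (β k).exp + (τ j).exp - (ω j).exp⟩, ?_⟩
  ext1 i k
  have hij := congrFun (congrFun h i) j
  simp only [starMul, SymType.mk.injEq] at hij ⊢
  constructor
  · have sign_eq : (α i).sign = (σ i).sign * ((ω j).sign * (τ j).sign) := by
      rw [mul_left_comm, ← hij.1, mul_left_comm, Int.units_mul_self, mul_one]
    rw [sign_eq, mul_assoc]
  · omega

theorem exists_hasSymMatrix_revProd [NeZero s] (n : ℕ) {F : Fin (n + 1) → LMat s s}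
    {S : Fin (n + 1) → Matrix (Fin s) (Fin s) SymType} (hF : ∀ j, HasSymMatrix (F j) (S j))
    (hS : ∀ j : Fin n, MutuallyCompatible (S j.succ) (S j.castSucc))
    (h0 : ∃ σ τ, S 0 = starMul σ τ) :
    ∃ α β ω, S (Fin.last n) = starMul α ω ∧ HasSymMatrix (revProd F) (starMul α β) := by
  induction n with
  | zero =>
    obtain ⟨σ, τ, h⟩ := h0
    refine ⟨σ, τ, τ, h, ?_⟩
    rw [← Fin.cons_self_tail F, revProd_cons, revProd_zero, Matrix.one_mul, ← h]
    exact hF 0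
  | succ n ih =>
    obtain ⟨α, β, ω, hα, hprod⟩ := ih (F := fun j => F j.castSucc) (S := fun j => S j.castSucc)
      (fun j => hF _) (fun j => hS j.castSucc) h0
    obtain ⟨σ₁, σ, σ₂, hlast, hσ⟩ := hS (Fin.last n)
    obtain ⟨β', hβ'⟩ := exists_starMul_eq_starMul (hα.symm.trans hσ) 0 β
    refine ⟨σ₁, β', σ, hlast, ?_⟩
    rw [← Fin.snoc_init_self F, revProd_snoc]
    have hFlast := hF (Fin.last (n + 1))
    rw [← Fin.succ_last, hlast] at hFlast
    rw [hβ'] at hprod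
    exact hFlast.mul hprod

variable {J : ℕ} {P : LMat r s} {U₁ : LMat r r} {U₂ : LMat s s} {F : Fin (J + 2) → LMat s s}

theorem IsCascade.isParaunitary (hrs : r ≤ s) (h : IsCascade K P U₁ U₂ J F) : IsParaunitary P := by
  rw [h.product]
  exact (isParaunitary_firstRows hrs).mul h.paraunitary

theorem IsCascade.hasCompatibleSym [NeZero s] (hrs : r ≤ s) (h : IsCascade K P U₁ U₂ J F) :
    HasCompatibleSym P := by
  obtain ⟨S, hF, hS⟩ := h.symm
  obtain ⟨σ₁, σ, σ₂, -, h0⟩ := hS 0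
  obtain ⟨α, β, -, -, hprod⟩ := exists_hasSymMatrix_revProd (J + 1) hF hS ⟨σ, σ₂, h0⟩
  refine ⟨fun i => α (Fin.castLE hrs i), β, fun i j => ?_⟩
  rw [h.product, firstRows_mul_apply hrs]
  exact hprod _ _

end Converse

end SymExt

end

theorem mainTheorem5 (K : Subfield ℂ) (hK : SymExt.IsAdmissibleField K) (r s : ℕ)
    (hr : 1 ≤ r) (hrs : r ≤ s) (P : SymExt.LMat r s) (hP : SymExt.HasCoeffsIn K P) :
    ((SymExt.IsParaunitary P ∧ SymExt.HasCompatibleSym P) ↔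
      ∃ (σ₁ : Fin r → SymExt.SymType) (σ₂ : Fin s → SymExt.SymType)
        (U₁ : SymExt.LMat r r) (U₂ : SymExt.LMat s s),
        SymExt.IsReorganizer σ₁ U₁ ∧ SymExt.IsReorganizer σ₂ U₂ ∧
        ∃ (J : ℕ) (F : Fin (J + 2) → SymExt.LMat s s), SymExt.IsCascade K P U₁ U₂ J F) ∧
    (SymExt.IsParaunitary P →
      ∀ (σ₁ : Fin r → SymExt.SymType) (σ₂ : Fin s → SymExt.SymType)
        (U₁ : SymExt.LMat r r) (U₂ : SymExt.LMat s s),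
        SymExt.HasSymMatrix P (SymExt.starMul σ₁ σ₂) →
        SymExt.IsReorganizer σ₁ U₁ → SymExt.IsReorganizer σ₂ U₂ →
        ∃ (J : ℕ) (F : Fin (J + 2) → SymExt.LMat s s), SymExt.IsCascade K P U₁ U₂ J F) := by
  have : NeZero s := ⟨by omega⟩
  have exists_cascade (hPp : SymExt.IsParaunitary P) σ₁ σ₂ U₁ U₂
      (hPs : SymExt.HasSymMatrix P (SymExt.starMul σ₁ σ₂)) (hU₁ : SymExt.IsReorganizer σ₁ U₁)
      (hU₂ : SymExt.IsReorganizer σ₂ U₂) := SymExt.exists_isCascade hK hrs ⟨hPp, hP, hPs⟩ hU₁ hU₂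
  refine ⟨⟨fun ⟨hPp, σ₁, σ₂, hPs⟩ => ?_, fun ⟨_, _, _, _, _, _, _, _, h⟩ =>
    ⟨h.isParaunitary hrs, h.hasCompatibleSym hrs⟩⟩, exists_cascade⟩
  obtain ⟨U₁, hU₁⟩ := SymExt.exists_isReorganizer σ₁
  obtain ⟨U₂, hU₂⟩ := SymExt.exists_isReorganizer σ₂
  exact ⟨σ₁, σ₂, U₁, U₂, hU₁, hU₂, exists_cascade hPp σ₁ σ₂ U₁ U₂ hPs hU₁ hU₂⟩
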